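/- Let $\alpha,\beta,\mu\in\mathbb R\setminus\{0\}$ with $\Delta:=\alpha^2+\beta^2-2\mu^2>0$. For $x_1,x_2\in\mathbb R$ put $y_1=x+(\alpha^2-3\beta^2)t+x_1$, $y_2=x+(3\alpha^2-\beta^2)t+x_2$, $$G_\mu=\frac{\beta\sqrt{\alpha^2+\beta^2}}{\alpha\sqrt\Delta}\sin(\alpha y_1)-\frac{\sqrt2\,\mu\beta\,[\cosh(\beta y_2)+\sinh(\beta y_2)]}{\Delta},\qquad F_\mu=\cosh(\beta y_2)-\frac{\sqrt2\,\mu\beta\,[\alpha\cos(\alpha y_1)-\beta\sin(\alpha y_1)]}{\alpha\sqrt{\alpha^2+\beta^2}\sqrt\Delta},$$ and let the Gardner breather be $$B_\mu(t,x;x_1,x_2)=2\sqrt2\,\partial_x\arctan\frac{G_\mu}{F_\mu}=2\sqrt2\,\frac{F_\mu\,\partial_xG_\mu-G_\mu\,\partial_xF_\mu}{F_\mu^2+G_\mu^2},$$ where the last expression is the definition at the points where $F_\mu=0$. For $w\in H^2(\mathbb R)$ (real-valued) put $$M[w]=\tfrac12\int w^2,\qquad E_\mu[w]=\tfrac12\int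 w_x^2-\mu\int w^3-\tfrac14\int w^4,$$ $$F_\mu[w]=\tfrac12\int w_{xx}^2-5\mu\int ww_x^2+\tfrac52\mu^2\int w^4-\tfrac52\int w^2w_x^2+\tfrac32\mu\int w^5+\tfrac14\int w^6,$$ $$\mathcal H_\mu[w]=F_\mu[w]+2(\beta^2-\alpha^2)E_\mu[w]+(\alpha^2+\beta^2)^2M[w].$$ With $B_\mu=B_\mu(t,\cdot\,;x_1,x_2)$ let, for $z\in H^4(\mathbb R)$, $$\begin{aligned}\mathcal L_\mu[z]={}&z_{4x}-2(\beta^2-\alpha^2)z_{xx}+(\alpha^2+\beta^2)^2z+5B_\mu^2z_{xx}+10B_\mu B_{\mu,x}z_x\\&+\big(5B_{\mu,x}^2+10B_\mu B_{\mu,xx}+\tfrac{15}2B_\mu^4-6(\beta^2-\alpha^2)B_\mu^2\big)z+10\mu B_\mu z_{xx}+10\mu B_{\mu,x}z_x\\&+3\mu\big(10B_\mu^3-4(\beta^2-\alpha^2)B_\mu+\tfrac{10}3B_{\mu,xx}+10\mu B_\mu^2\big)z,\end{aligned}$$ and for $z\in H^2(\mathbb R)$ let $$\begin{aligned}\mathcal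 Q_\mu[z]={}&\int z_{xx}^2+2(\beta^2-\alpha^2)\int z_x^2+(\alpha^2+\beta^2)^2\int z^2-5\int B_\mu^2z_x^2-10\mu\int B_\mu z_x^2\\&+\int\big(5B_{\mu,x}^2+10B_\mu B_{\mu,xx}+\tfrac{15}2B_\mu^4-6(\beta^2-\alpha^2)B_\mu^2\big)z^2\\&+3\mu\int\big(10B_\mu^3-4(\beta^2-\alpha^2)B_\mu+\tfrac{10}3B_{\mu,xx}+10\mu B_\mu^2\big)z^2 .\end{aligned}$$ There are $\eta>0$ and $K$, depending only on $\alpha,\beta,\mu$, such that for all $x_1,x_2,t\in\mathbb R$ the function $B_\mu=B_\mu(t,\cdot\,;x_1,x_2)$ belongs to $H^2(\mathbb R)$ and 1. $B_\mu$ is a critical point of $\mathcal H_\mu$: the functional $\mathcal H_\mu:H^2(\mathbb R)\to\mathbb R$ is Fréchet differentiable at $B_\mu$ with derivative $0$; 2. $\mathcal Q_\mu[z]=\int_{\mathbb R}z\,\mathcal L_\mu[z]$ for every $z\in H^4(\mathbb R)$; 3. for every $z\in H^2(\mathbb R)$ with $\|z\|_{H^2(\mathbb R)}\le\eta$, $$\mathcal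 H_\mu[B_\mu+z]-\mathcal H_\mu[B_\mu]=\tfrac12\mathcal Q_\mu[z]+\mathcal N_\mu[z],\qquad |\mathcal N_\mu[z]|\le K\|z\|_{H^2(\mathbb R)}^3 .$$ -/

import Mathlib

open MeasureTheory
open scoped ENNReal ContDiff

noncomputable section

namespace Gardner

/-- `g` is the weak (distributional) derivative of `f` on the line; used below for
square-integrable `f` and `g`. -/
def IsWeakDeriv (f g : ℝ → ℝ) : Prop :=
  ∀ φ : ℝ → ℝ, ContDiff ℝ ∞ φ → HasCompactSupport φ →
    ∫ x, f x * deriv φ x = - ∫ x, g x * φ x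

theorem integrable_mul_test (f : Lp ℝ 2 (volume : Measure ℝ)) {ψ : ℝ → ℝ}
    (h1 : Continuous ψ) (h2 : HasCompactSupport ψ) :
    Integrable (fun x => f x * ψ x) volume :=
  MemLp.integrable_mul (p := 2) (q := 2) (Lp.memLp f) (h1.memLp_of_hasCompactSupport h2)

/-- The real Sobolev space `H^k(ℝ)`: a member is a square-integrable class together with its weak
derivatives of orders `1, …, k`, all square-integrable. The norm, inherited from the `ℓ²`-product,
is `‖w‖² = ∑_{j ≤ k} ‖∂ₓʲ w‖²_{L²}`. -/
def Sobolev (k : ℕ) :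
    Submodule ℝ (PiLp 2 (fun _ : Fin (k + 1) => Lp ℝ 2 (volume : Measure ℝ))) where
  carrier := {u | ∀ i : Fin k, IsWeakDeriv (u i.castSucc) (u i.succ)}
  zero_mem' := by
    intro i φ _ _
    have h : ((0 : Lp ℝ 2 (volume : Measure ℝ)) : ℝ → ℝ) =ᵐ[volume] 0 := Lp.coeFn_zero _ _ _
    have e1 : ∫ x, (0 : Lp ℝ 2 (volume : Measure ℝ)) x * deriv φ x = 0 := by
      refine integral_eq_zero_of_ae ?_
      filter_upwards [h] with x hx
      rw [hx]
      simp
    have e2 : ∫ x, (0 : Lp ℝ 2 (volume : Measure ℝ)) x * φ x = 0 := by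
      refine integral_eq_zero_of_ae ?_
      filter_upwards [h] with x hx
      rw [hx]
      simp
    simp only [PiLp.zero_apply]
    rw [e1, e2, neg_zero]
  add_mem' := by
    intro u v hu hv i φ h1 h2
    have key : ∀ (f g : Lp ℝ 2 (volume : Measure ℝ)) (ψ : ℝ → ℝ), Continuous ψ →
        HasCompactSupport ψ →
        ∫ x, (f + g) x * ψ x = (∫ x, f x * ψ x) + ∫ x, g x * ψ x := by
      intro f g ψ c1 c2
      rw [← integral_add (integrable_mul_test f c1 c2) (integrable_mul_test g c1 c2)]
      refine integral_congr_ae ?_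
      filter_upwards [Lp.coeFn_add f g] with x hx
      rw [hx, ← add_mul]
      rfl
    simp only [PiLp.add_apply]
    rw [key _ _ _ (h1.continuous_deriv (by simp)) h2.deriv, key _ _ _ h1.continuous h2,
      hu i φ h1 h2, hv i φ h1 h2]
    ring
  smul_mem' := by
    intro c u hu i φ h1 h2
    have key : ∀ (f : Lp ℝ 2 (volume : Measure ℝ)) (ψ : ℝ → ℝ),
        ∫ x, (c • f) x * ψ x = c * ∫ x, f x * ψ x := by
      intro f ψ
      rw [← integral_const_mul]
      refine integral_congr_ae ?_
      filter_upwards [Lp.coeFn_smul c f] with x hx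
      rw [hx, Pi.smul_apply, smul_eq_mul, mul_assoc]
    simp only [PiLp.smul_apply]
    rw [key, key, hu i φ h1 h2]
    ring

/-- `w.der j` is (a representative of) the `j`-th weak derivative `∂ₓʲ w`; `w.der 0` is `w`. -/
def Sobolev.der {k : ℕ} (w : Sobolev k) (j : Fin (k + 1)) : ℝ → ℝ := w.1 j

/-- The mass `M[w] = ½ ∫ w²`. -/
def mass (w : Sobolev 2) : ℝ := 1 / 2 * ∫ x, Sobolev.der w 0 x ^ 2

/-- The energy `E_μ[w] = ½ ∫ w_x² - μ ∫ w³ - ¼ ∫ w⁴`. -/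
def energy (μ : ℝ) (w : Sobolev 2) : ℝ :=
  1 / 2 * (∫ x, Sobolev.der w 1 x ^ 2) - μ * (∫ x, Sobolev.der w 0 x ^ 3)
    - 1 / 4 * ∫ x, Sobolev.der w 0 x ^ 4

/-- The third conserved quantity
`F_μ[w] = ½ ∫ w_xx² - 5μ ∫ w w_x² + (5/2)μ² ∫ w⁴ - (5/2) ∫ w² w_x² + (3/2)μ ∫ w⁵ + ¼ ∫ w⁶`. -/
def thirdQuantity (μ : ℝ) (w : Sobolev 2) : ℝ :=
  1 / 2 * (∫ x, Sobolev.der w 2 x ^ 2)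
    - 5 * μ * (∫ x, Sobolev.der w 0 x * Sobolev.der w 1 x ^ 2)
    + 5 / 2 * μ ^ 2 * (∫ x, Sobolev.der w 0 x ^ 4)
    - 5 / 2 * (∫ x, Sobolev.der w 0 x ^ 2 * Sobolev.der w 1 x ^ 2)
    + 3 / 2 * μ * (∫ x, Sobolev.der w 0 x ^ 5)
    + 1 / 4 * ∫ x, Sobolev.der w 0 x ^ 6

/-- The Lyapunov functional `𝓗_μ = F_μ + 2(β² - α²) E_μ + (α² + β²)² M` on `H²(ℝ)`. -/
def lyapunov (α β μ : ℝ) (w : Sobolev 2) : ℝ :=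
  thirdQuantity μ w + 2 * (β ^ 2 - α ^ 2) * energy μ w + (α ^ 2 + β ^ 2) ^ 2 * mass w

/-- `Δ = α² + β² - 2μ²`. -/
def Del (α β μ : ℝ) : ℝ := α ^ 2 + β ^ 2 - 2 * μ ^ 2

/-- `y₁ = x + δ t + x₁`, `δ = α² - 3β²`. -/
def yOne (α β x₁ t x : ℝ) : ℝ := x + (α ^ 2 - 3 * β ^ 2) * t + x₁

/-- `y₂ = x + γ t + x₂`, `γ = 3α² - β²`. -/
def yTwo (α β x₂ t x : ℝ) : ℝ := x + (3 * α ^ 2 - β ^ 2) * t + x₂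

/-- The function `G_μ` of the Gardner breather. -/
def breatherG (α β μ x₁ x₂ t x : ℝ) : ℝ :=
  β * √(α ^ 2 + β ^ 2) / (α * √(Del α β μ)) * Real.sin (α * yOne α β x₁ t x)
    - √2 * μ * β * (Real.cosh (β * yTwo α β x₂ t x) + Real.sinh (β * yTwo α β x₂ t x))
      / Del α β μ

/-- The function `F_μ` of the Gardner breather. -/
def breatherF (α β μ x₁ x₂ t x : ℝ) : ℝ :=
  Real.cosh (β * yTwo α β x₂ t x)
    - √2 * μ * β * (α * Real.cos (α * yOne α β x₁ t x) - β * Real.sin (α * yOne α β x₁ t x))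
      / (α * √(α ^ 2 + β ^ 2) * √(Del α β μ))

/-- The Gardner breather `B_μ = 2√2 ∂ₓ arctan (G_μ / F_μ)`. The derivative is written out as
`(F G_x - G F_x) / (F² + G²)`, which is also meaningful at the points where `F_μ` vanishes (there
the angle is continued smoothly); `breather_eq_deriv_arctan` and `sq_add_sq_breather_pos` below
justify this. -/
def breather (α β μ x₁ x₂ t x : ℝ) : ℝ :=
  2 * √2 *
    ((breatherF α β μ x₁ x₂ t x * deriv (breatherG α β μ x₁ x₂ t) x
        - breatherG α β μ x₁ x₂ t x * deriv (breatherF α β μ x₁ x₂ t) x)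
      / (breatherF α β μ x₁ x₂ t x ^ 2 + breatherG α β μ x₁ x₂ t x ^ 2))

theorem breather_eq_deriv_arctan (α β μ x₁ x₂ t x : ℝ) (h : breatherF α β μ x₁ x₂ t x ≠ 0) :
    breather α β μ x₁ x₂ t x =
      2 * √2 * deriv (fun s =>
        Real.arctan (breatherG α β μ x₁ x₂ t s / breatherF α β μ x₁ x₂ t s)) x := by
  have hG : Differentiable ℝ (breatherG α β μ x₁ x₂ t) := by
    unfold breatherG yOne yTwo; fun_prop
  have hF : Differentiable ℝ (breatherF α β μ x₁ x₂ t) := by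
    unfold breatherF yOne yTwo; fun_prop
  have := (((hG x).hasDerivAt.div (hF x).hasDerivAt h).arctan).deriv
  have e : (fun s => Real.arctan (breatherG α β μ x₁ x₂ t s / breatherF α β μ x₁ x₂ t s))
      = fun s => Real.arctan ((breatherG α β μ x₁ x₂ t / breatherF α β μ x₁ x₂ t) s) := rfl
  rw [e, this]
  unfold breather
  have h2 : breatherF α β μ x₁ x₂ t x ^ 2 + breatherG α β μ x₁ x₂ t x ^ 2 ≠ 0 := by positivity
  simp only [Pi.div_apply]
  field_simp

theorem sq_add_sq_breather_pos (α β μ x₁ x₂ t x : ℝ) (hα : α ≠ 0) (hβ : β ≠ 0)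
    (hΔ : 0 < Del α β μ) :
    0 < breatherF α β μ x₁ x₂ t x ^ 2 + breatherG α β μ x₁ x₂ t x ^ 2 := by
  have hρ : 0 < α ^ 2 + β ^ 2 := by positivity
  by_contra hcon
  have hF : breatherF α β μ x₁ x₂ t x = 0 := by
    have q1 := sq_nonneg (breatherF α β μ x₁ x₂ t x)
    have q2 := sq_nonneg (breatherG α β μ x₁ x₂ t x)
    exact pow_eq_zero_iff two_ne_zero |>.1 (by linarith)
  have hG : breatherG α β μ x₁ x₂ t x = 0 := by
    have q1 := sq_nonneg (breatherF α β μ x₁ x₂ t x)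
    have q2 := sq_nonneg (breatherG α β μ x₁ x₂ t x)
    exact pow_eq_zero_iff two_ne_zero |>.1 (by linarith)
  unfold breatherF at hF
  unfold breatherG at hG
  rw [Real.cosh_add_sinh] at hG
  set E := Real.exp (β * yTwo α β x₂ t x)
  set h := Real.cosh (β * yTwo α β x₂ t x) with hh
  set s := Real.sin (α * yOne α β x₁ t x) with hs
  set c := Real.cos (α * yOne α β x₁ t x) with hc
  have hsc : s ^ 2 + c ^ 2 = 1 := Real.sin_sq_add_cos_sq _
  have hhE : 1 / 2 ≤ h * E := by
    have e1 : h = (E + E⁻¹) / 2 := by rw [hh, Real.cosh_eq, Real.exp_neg]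
    have hE : 0 < E := Real.exp_pos _
    have e2 : h * E = (E ^ 2 + 1) / 2 := by rw [e1]; field_simp
    nlinarith [sq_nonneg E]
  have hh0 : 0 < h := Real.cosh_pos _
  have hr2 : √(α ^ 2 + β ^ 2) ^ 2 = α ^ 2 + β ^ 2 := Real.sq_sqrt hρ.le
  have hd2 : √(Del α β μ) ^ 2 = Del α β μ := Real.sq_sqrt hΔ.le
  have hr : 0 < √(α ^ 2 + β ^ 2) := Real.sqrt_pos.2 hρ
  have hd : 0 < √(Del α β μ) := Real.sqrt_pos.2 hΔ
  set r := √(α ^ 2 + β ^ 2)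
  set d := √(Del α β μ)
  set m := √2 * μ
  rw [← hd2] at hG
  have g1 : s * (r * d) = m * α * E := by
    have e3 : β * r / (α * d) * s - m * β * E / d ^ 2 = β / (α * d ^ 2) * (s * (r * d) - m * α * E) := by
      field_simp
    rw [e3] at hG
    have e4 : β / (α * d ^ 2) ≠ 0 := by positivity
    exact sub_eq_zero.1 ((mul_eq_zero.1 hG).resolve_left e4)
  have f1 : h * (r * d) ^ 2 + m ^ 2 * β ^ 2 * E = m * β * c * (r * d) := by
    field_simp at hF
    have f2 : h * α * r * d = m * β * (α * c - β * s) := by linarith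
    have : α * (h * (r * d) ^ 2 + m ^ 2 * β ^ 2 * E) = α * (m * β * c * (r * d)) := by
      linear_combination (r * d) * f2 - m * β ^ 2 * g1
    exact mul_left_cancel₀ hα this
  have hR : 0 < (r * d) ^ 2 := by positivity
  have k1 : (h * (r * d) ^ 2 + m ^ 2 * β ^ 2 * E) ^ 2 ≤ m ^ 2 * β ^ 2 * (r * d) ^ 2 := by
    rw [f1]
    have : (m * β * c * (r * d)) ^ 2 = m ^ 2 * β ^ 2 * (r * d) ^ 2 * c ^ 2 := by ring
    rw [this]
    have h0 : 0 ≤ m ^ 2 * β ^ 2 * (r * d) ^ 2 := by positivity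
    nlinarith [sq_nonneg s]
  have k2 : m ^ 2 * β ^ 2 * (r * d) ^ 2 * (1 / 2) ≤ m ^ 2 * β ^ 2 * (r * d) ^ 2 * (h * E) :=
    mul_le_mul_of_nonneg_left hhE (by positivity)
  have k3 : 0 < (h * (r * d) ^ 2) ^ 2 := by positivity
  nlinarith [sq_nonneg (m ^ 2 * β ^ 2 * E)]

/-- The linearized operator `𝓛_μ` at a profile `B` (to be the breather at a fixed time), acting
on `z ∈ H⁴(ℝ)`. -/
def linearizedOp (α β μ : ℝ) (B : ℝ → ℝ) (z : Sobolev 4) (x : ℝ) : ℝ :=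
  Sobolev.der z 4 x - 2 * (β ^ 2 - α ^ 2) * Sobolev.der z 2 x
    + (α ^ 2 + β ^ 2) ^ 2 * Sobolev.der z 0 x
    + 5 * B x ^ 2 * Sobolev.der z 2 x + 10 * B x * deriv B x * Sobolev.der z 1 x
    + (5 * deriv B x ^ 2 + 10 * B x * deriv (deriv B) x + 15 / 2 * B x ^ 4
        - 6 * (β ^ 2 - α ^ 2) * B x ^ 2) * Sobolev.der z 0 x
    + 10 * μ * B x * Sobolev.der z 2 x + 10 * μ * deriv B x * Sobolev.der z 1 x
    + 3 * μ * (10 * B x ^ 3 - 4 * (β ^ 2 - α ^ 2) * B x + 10 / 3 * deriv (deriv B) x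
        + 10 * μ * B x ^ 2) * Sobolev.der z 0 x

/-- The quadratic form `𝓠_μ[z]` associated with the linearized operator, on its form domain
`H²(ℝ)`: this is `∫ z 𝓛_μ[z]` with the terms in `z_4x` and `z_xx` integrated by parts. -/
def quadForm (α β μ : ℝ) (B : ℝ → ℝ) (z : Sobolev 2) : ℝ :=
  (∫ x, Sobolev.der z 2 x ^ 2) + 2 * (β ^ 2 - α ^ 2) * (∫ x, Sobolev.der z 1 x ^ 2)
    + (α ^ 2 + β ^ 2) ^ 2 * (∫ x, Sobolev.der z 0 x ^ 2)
    - 5 * (∫ x, B x ^ 2 * Sobolev.der z 1 x ^ 2)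
    - 10 * μ * (∫ x, B x * Sobolev.der z 1 x ^ 2)
    + (∫ x, (5 * deriv B x ^ 2 + 10 * B x * deriv (deriv B) x + 15 / 2 * B x ^ 4
        - 6 * (β ^ 2 - α ^ 2) * B x ^ 2) * Sobolev.der z 0 x ^ 2)
    + 3 * μ * ∫ x, (10 * B x ^ 3 - 4 * (β ^ 2 - α ^ 2) * B x + 10 / 3 * deriv (deriv B) x
        + 10 * μ * B x ^ 2) * Sobolev.der z 0 x ^ 2

end Gardner

end

open MeasureTheory
open scoped ENNReal ContDiff

noncomputable section

namespace Gardner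

/-! ### Bilinear identities for the tau function of the breather -/

/-! Put `m = √2 μ` and `w = B / √2 = 2 (F Gₓ - G Fₓ) / (F² + G²)`, so that `w = 2 ∂ₓ arg (F + iG)`.
After a rescaling and a shift of the phase of `y₂`, both `F` and `G` are linear forms in the modes
`e = exp(βy)`, `f = exp(-βy)`, `s = sin(αy')`, `c = cos(αy')`, with coefficients polynomial in `α,
β, m`. Derivatives in `x` and `t` act on the coefficients, so every relation between them is a
polynomial identity modulo `e f = 1` and `s² + c² = 1`.

Divided by powers of `F² + G²`, these identities say the following. The logarithmic derivative of
`F² + G²` has derivative `w² + m w` (`hasDerivAt_logD`). The profile solves the Gardner equation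
integrated once, `wₓₓ + 2w³ + 3mw² + p = 0`, where `p` is the time derivative of the potential `2
arg (F + iG)` (`hasDerivAt_prof₁`). Two more relations contain the same combination of mixed `x,t`
derivatives of `F` and `G`; eliminating it gives a fourth-order equation for `w`
(`prof_stationary`), which for `B` is the Euler-Lagrange equation of `𝓗_μ`. In the proof `t` is a
parameter, and `p` is just another quotient of forms in the modes.

A lower bound `F² + G² ≥ C cosh²` with `C` independent of the phases (`cosh_sq_le_tauSq`) makes `B`
and four derivatives `O(1/cosh)`, uniformly in `x₁, x₂, t`.

The densities of `𝓗_μ` are polynomials, so the density at `B + z` minus the one at `B` minus half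
the quadratic density equals `z` times the Euler-Lagrange expression, plus exact derivatives, plus a
cubic remainder (`lyapunov_expansion`). The first term vanishes by the equation, the exact
derivatives by integration by parts in `H¹`. As `w_xx` enters the density only through `½ w_xx²`,
each term of the remainder is `z` times a quadratic expression in `z, zₓ`; the embedding of `H¹`
into the bounded functions gives the cubic bound. Criticality follows from this bound and the
boundedness of `𝓠_μ` on `H²`. -/

/-- The real part of the tau function, as a linear form in the modes `exp(βy)`, `exp(-βy)`,
`sin(αy')`, `cos(αy')`. -/
def tauRe (α β m e f s c : ℝ) : ℝ :=
  α * (α ^ 2 + β ^ 2 - m ^ 2) * e + α * (α ^ 2 + β ^ 2) * f - 2 * m * β * α * c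
    + 2 * m * β ^ 2 * s

/-- The imaginary part of the tau function, as a linear form in the modes. -/
def tauIm (α β m e s : ℝ) : ℝ :=
  2 * β * (α ^ 2 + β ^ 2) * s - 2 * m * α * β * e

/-- The linear forms in the mixed modes `e s, e c, f s, f c, 1`. -/
def mixed (a : Fin 5 → ℝ) (e f s c : ℝ) : ℝ :=
  a 0 * (e * s) + a 1 * (e * c) + a 2 * (f * s) + a 3 * (f * c) + a 4

/-- The action of `∂ₓ` on the coefficients of a form in the mixed modes. -/
def mixedShift (α β : ℝ) (a : Fin 5 → ℝ) : Fin 5 → ℝ :=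
  ![β * a 0 - α * a 1, α * a 0 + β * a 1, -β * a 2 - α * a 3, α * a 2 - β * a 3, 0]

/-- Coefficients of `2 (F Gₓ - G Fₓ)` in the mixed modes. -/
def coeffX (α β m : ℝ) : Fin 5 → ℝ :=
  ![-4 * α * β ^ 2 * ((α ^ 2 + β ^ 2) ^ 2 - 3 * α ^ 2 * m ^ 2 + β ^ 2 * m ^ 2),
    4 * α ^ 2 * β * ((α ^ 2 + β ^ 2) ^ 2 - α ^ 2 * m ^ 2 + 3 * β ^ 2 * m ^ 2),
    4 * α * β ^ 2 * (α ^ 2 + β ^ 2) ^ 2,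
    4 * α ^ 2 * β * (α ^ 2 + β ^ 2) ^ 2,
    -16 * α ^ 2 * β ^ 2 * m * (α ^ 2 + β ^ 2)]

/-- Coefficients of `2 (F Gₜ - G Fₜ)` in the mixed modes. -/
def coeffT (α β m : ℝ) : Fin 5 → ℝ :=
  ![-4 * α * β ^ 2 * ((α ^ 2 + β ^ 2) ^ 2 * (3 * α ^ 2 - β ^ 2)
      - m ^ 2 * (5 * α ^ 4 - 10 * α ^ 2 * β ^ 2 + β ^ 4)),
    4 * α ^ 2 * β * ((α ^ 2 + β ^ 2) ^ 2 * (α ^ 2 - 3 * β ^ 2)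
      - m ^ 2 * (α ^ 4 - 10 * α ^ 2 * β ^ 2 + 5 * β ^ 4)),
    4 * α * β ^ 2 * (α ^ 2 + β ^ 2) ^ 2 * (3 * α ^ 2 - β ^ 2),
    4 * α ^ 2 * β * (α ^ 2 + β ^ 2) ^ 2 * (α ^ 2 - 3 * β ^ 2),
    -32 * α ^ 2 * β ^ 2 * m * (α ^ 4 - β ^ 4)]

section Identities

variable (α β m e f s c : ℝ)

/-- Squares of modes drop out of a Wronskian: the terms in `e²` and in `s c` cancel, while `e f` and
`s² + c²` are constants. Hence only mixed products and a constant remain, and further derivatives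
stay in a five-dimensional space. -/
theorem tau_wronskian (hef : e * f = 1) (hsc : s ^ 2 + c ^ 2 = 1) :
    2 * (tauRe α β m e f s c * tauIm α β m (β * e) (α * c)
      - tauIm α β m e s * tauRe α β m (β * e) (-β * f) (α * c) (-α * s))
      = mixed (coeffX α β m) e f s c := by
  simp [tauRe, tauIm, mixed, coeffX]
  grind

/-- The bilinear equation `F Fₓₓ + G Gₓₓ - Fₓ² - Gₓ² = m (F Gₓ - G Fₓ)`. It removes the second
derivatives of `F` and `G` from `∂ₓ² log (F² + G²)`. -/
theorem tau_bilinear (hef : e * f = 1) (hsc : s ^ 2 + c ^ 2 = 1) :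
    tauRe α β m e f s c * tauRe α β m (β ^ 2 * e) (β ^ 2 * f) (-α ^ 2 * s) (-α ^ 2 * c)
      + tauIm α β m e s * tauIm α β m (β ^ 2 * e) (-α ^ 2 * s)
      - tauRe α β m (β * e) (-β * f) (α * c) (-α * s) ^ 2
      - tauIm α β m (β * e) (α * c) ^ 2
      = m / 2 * mixed (coeffX α β m) e f s c := by
  simp [tauRe, tauIm, mixed, coeffX]
  grind

/-- `F² + G²` -/
def tauSq : ℝ := tauRe α β m e f s c ^ 2 + tauIm α β m e s ^ 2

/-- `∂ₓ (F² + G²)` -/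
def tauSqX : ℝ :=
  2 * (tauRe α β m e f s c * tauRe α β m (β * e) (-β * f) (α * c) (-α * s)
    + tauIm α β m e s * tauIm α β m (β * e) (α * c))

/-- `Fₓ² + Gₓ²` -/
def tauXX : ℝ :=
  tauRe α β m (β * e) (-β * f) (α * c) (-α * s) ^ 2 + tauIm α β m (β * e) (α * c) ^ 2

/-- `Fₓ Fₜ + Gₓ Gₜ` -/
def tauXT : ℝ :=
  tauRe α β m (β * e) (-β * f) (α * c) (-α * s)
      * tauRe α β m ((3 * α ^ 2 - β ^ 2) * (β * e)) ((3 * α ^ 2 - β ^ 2) * (-β * f))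
          ((α ^ 2 - 3 * β ^ 2) * (α * c)) ((α ^ 2 - 3 * β ^ 2) * (-α * s))
    + tauIm α β m (β * e) (α * c)
      * tauIm α β m ((3 * α ^ 2 - β ^ 2) * (β * e)) ((α ^ 2 - 3 * β ^ 2) * (α * c))

/-- `∂ₓ∂ₜ (F² + G²)` -/
def tauSqXT : ℝ :=
  2 * (tauXT α β m e f s c
    + tauRe α β m e f s c
      * tauRe α β m ((3 * α ^ 2 - β ^ 2) * (β ^ 2 * e)) ((3 * α ^ 2 - β ^ 2) * (β ^ 2 * f))
          ((α ^ 2 - 3 * β ^ 2) * (-α ^ 2 * s)) ((α ^ 2 - 3 * β ^ 2) * (-α ^ 2 * c))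
    + tauIm α β m e s
      * tauIm α β m ((3 * α ^ 2 - β ^ 2) * (β ^ 2 * e)) ((α ^ 2 - 3 * β ^ 2) * (-α ^ 2 * s)))

/-- Lagrange's identity `(F Fₓ + G Gₓ)² + (F Gₓ - G Fₓ)² = (F² + G²)(Fₓ² + Gₓ²)`; the relations
between the modes serve only to rewrite the Wronskian. -/
theorem tauSqX_sq (hef : e * f = 1) (hsc : s ^ 2 + c ^ 2 = 1) :
    tauSqX α β m e f s c ^ 2 + mixed (coeffX α β m) e f s c ^ 2
      = 4 * tauSq α β m e f s c * tauXX α β m e f s c := by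
  rw [← tau_wronskian α β m e f s c hef hsc]
  unfold tauSqX tauSq tauXX
  ring

/-- The once integrated Gardner equation with denominators cleared. As in the next two identities,
the long polynomials are the cofactors that exhibit the left side as a member of the ideal generated
by `e f - 1` and `s² + c² - 1`. -/
theorem mixed_evolution (hef : e * f = 1) (hsc : s ^ 2 + c ^ 2 = 1) :
    mixed (mixedShift α β (mixedShift α β (coeffX α β m))) e f s c * tauSq α β m e f s c
      - 2 * tauSqX α β m e f s c * mixed (mixedShift α β (coeffX α β m)) e f s c
      + 4 * tauXX α β m e f s c * mixed (coeffX α β m) e f s c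
      + 2 * m * mixed (coeffX α β m) e f s c ^ 2
      + mixed (coeffT α β m) e f s c * tauSq α β m e f s c = 0 := by
  simp [tauRe, tauIm, mixed, mixedShift, coeffX, coeffT, tauSq, tauSqX, tauXX]
  linear_combination (64 * α ^ 2 * β ^ 2 * ((α ^ 9 * β ^ 2 + 4 * α ^ 7 * β ^ 4 - 3 * α ^ 7 * β ^ 2 * m ^ 2 +
    6 * α ^ 5 * β ^ 6 - 5 * α ^ 5 * β ^ 4 * m ^ 2 + 4 * α ^ 5 * β ^ 2 * m ^ 4 + 4 * α ^ 3 * β ^ 8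
    - α ^ 3 * β ^ 6 * m ^ 2 + 4 * α ^ 3 * β ^ 4 * m ^ 4 + α * β ^ 10 + α * β ^ 8 * m ^ 2) * e * s
    + (-α ^ 10 * β - 4 * α ^ 8 * β ^ 3 + 3 * α ^ 8 * β * m ^ 2 - 6 * α ^ 6 * β ^ 5 +
    5 * α ^ 6 * β ^ 3 * m ^ 2 - 2 * α ^ 6 * β * m ^ 4 - 4 * α ^ 4 * β ^ 7 + α ^ 4 * β ^ 5 * m ^ 2
    - α ^ 2 * β ^ 9 - α ^ 2 * β ^ 7 * m ^ 2 + 2 * α ^ 2 * β ^ 5 * m ^ 4) * e * c + (-α ^ 9 * β ^ 2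
    - 4 * α ^ 7 * β ^ 4 - 6 * α ^ 5 * β ^ 6 - 4 * α ^ 3 * β ^ 8 - α * β ^ 10) * f * s +
    (-α ^ 10 * β - 4 * α ^ 8 * β ^ 3 + 2 * α ^ 8 * β * m ^ 2 - 6 * α ^ 6 * β ^ 5 +
    6 * α ^ 6 * β ^ 3 * m ^ 2 - 4 * α ^ 4 * β ^ 7 + 6 * α ^ 4 * β ^ 5 * m ^ 2 - α ^ 2 * β ^ 9 +
    2 * α ^ 2 * β ^ 7 * m ^ 2) * f * c + (α ^ 10 * m + 2 * α ^ 8 * β ^ 2 * m - α ^ 8 * m ^ 3 -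
    2 * α ^ 6 * β ^ 4 * m - 3 * α ^ 6 * β ^ 2 * m ^ 3 - 8 * α ^ 4 * β ^ 6 * m -
    5 * α ^ 4 * β ^ 4 * m ^ 3 - 7 * α ^ 2 * β ^ 8 * m - 5 * α ^ 2 * β ^ 6 * m ^ 3 - 2 * β ^ 10 * m
    - 2 * β ^ 8 * m ^ 3) * s ^ 2 + (4 * α ^ 5 * β ^ 3 * m ^ 3 + 8 * α ^ 3 * β ^ 5 * m ^ 3 +
    4 * α * β ^ 7 * m ^ 3) * s * c + (α ^ 10 * m + 4 * α ^ 8 * β ^ 2 * m - α ^ 8 * m ^ 3 +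
    6 * α ^ 6 * β ^ 4 * m - 5 * α ^ 6 * β ^ 2 * m ^ 3 + 4 * α ^ 4 * β ^ 6 * m -
    7 * α ^ 4 * β ^ 4 * m ^ 3 + α ^ 2 * β ^ 8 * m - 3 * α ^ 2 * β ^ 6 * m ^ 3) * c ^ 2 +
    (-α ^ 10 * m + α ^ 8 * m ^ 3 + 6 * α ^ 6 * β ^ 4 * m - α ^ 6 * β ^ 2 * m ^ 3 +
    8 * α ^ 4 * β ^ 6 * m - 5 * α ^ 4 * β ^ 4 * m ^ 3 + 3 * α ^ 2 * β ^ 8 * m -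
    3 * α ^ 2 * β ^ 6 * m ^ 3))) * hef +
    (32 * α ^ 3 * β ^ 2 * ((α ^ 9 * m + 4 * α ^ 7 * β ^ 2 * m - 2 * α ^ 7 * m ^ 3 +
    6 * α ^ 5 * β ^ 4 * m - 2 * α ^ 5 * β ^ 2 * m ^ 3 + α ^ 5 * m ^ 5 + 4 * α ^ 3 * β ^ 6 * m +
    2 * α ^ 3 * β ^ 4 * m ^ 3 + 2 * α ^ 3 * β ^ 2 * m ^ 5 + α * β ^ 8 * m + 2 * α * β ^ 6 * m ^ 3
    + α * β ^ 4 * m ^ 5) * e ^ 2 + (-2 * α ^ 8 * β ^ 2 - 8 * α ^ 6 * β ^ 4 +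
    2 * α ^ 6 * β ^ 2 * m ^ 2 - 12 * α ^ 4 * β ^ 6 - 2 * α ^ 4 * β ^ 4 * m ^ 2 +
    4 * α ^ 4 * β ^ 2 * m ^ 4 - 8 * α ^ 2 * β ^ 8 - 10 * α ^ 2 * β ^ 6 * m ^ 2 - 2 * β ^ 10 -
    6 * β ^ 8 * m ^ 2 - 4 * β ^ 6 * m ^ 4) * e * s + (2 * α ^ 9 * β + 8 * α ^ 7 * β ^ 3 -
    2 * α ^ 7 * β * m ^ 2 + 12 * α ^ 5 * β ^ 5 + 2 * α ^ 5 * β ^ 3 * m ^ 2 + 8 * α ^ 3 * β ^ 7 +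
    10 * α ^ 3 * β ^ 5 * m ^ 2 + 8 * α ^ 3 * β ^ 3 * m ^ 4 + 2 * α * β ^ 9 + 6 * α * β ^ 7 * m ^ 2
    + 8 * α * β ^ 5 * m ^ 4) * e * c + (α ^ 9 * m + 4 * α ^ 7 * β ^ 2 * m + 6 * α ^ 5 * β ^ 4 * m
    + 4 * α ^ 3 * β ^ 6 * m + α * β ^ 8 * m) * f ^ 2 + (2 * α ^ 8 * β ^ 2 + 8 * α ^ 6 * β ^ 4 +
    4 * α ^ 6 * β ^ 2 * m ^ 2 + 12 * α ^ 4 * β ^ 6 + 12 * α ^ 4 * β ^ 4 * m ^ 2 +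
    8 * α ^ 2 * β ^ 8 + 12 * α ^ 2 * β ^ 6 * m ^ 2 + 2 * β ^ 10 + 4 * β ^ 8 * m ^ 2) * f * s +
    (2 * α ^ 9 * β + 8 * α ^ 7 * β ^ 3 + 12 * α ^ 5 * β ^ 5 + 8 * α ^ 3 * β ^ 7 +
    2 * α * β ^ 9) * f * c + (2 * α ^ 9 * m - 2 * α ^ 7 * m ^ 3 - 12 * α ^ 5 * β ^ 4 * m -
    14 * α ^ 5 * β ^ 2 * m ^ 3 - 16 * α ^ 3 * β ^ 6 * m - 22 * α ^ 3 * β ^ 4 * m ^ 3 -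
    6 * α * β ^ 8 * m - 10 * α * β ^ 6 * m ^ 3))) * hsc

/-- After division by `(F² + G²)²` this expresses `(tauSqXT - 4 tauXT) / (F² + G²)` through the
profile, `pot` and their quotients: the relation used to eliminate the mixed derivatives from
`mixed_stationary`. -/
theorem mixed_quadratic (hef : e * f = 1) (hsc : s ^ 2 + c ^ 2 = 1) :
    mixed (mixedShift α β (coeffX α β m)) e f s c ^ 2
      - mixed (coeffX α β m) e f s c
        * mixed (mixedShift α β (mixedShift α β (coeffX α β m))) e f s c
      - tauSqXT α β m e f s c * tauSq α β m e f s c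
      + 4 * tauSq α β m e f s c * tauXT α β m e f s c
      + m * tauSq α β m e f s c * mixed (coeffT α β m) e f s c = 0 := by
  simp [tauRe, tauIm, mixed, mixedShift, coeffX, coeffT, tauSq, tauXT, tauSqXT]
  linear_combination (8 * α ^ 2 * β ^ 2 * ((-3 * α ^ 12 - 11 * α ^ 10 * β ^ 2 + 9 * α ^ 10 * m ^ 2 -
    14 * α ^ 8 * β ^ 4 + 12 * α ^ 8 * β ^ 2 * m ^ 2 - 9 * α ^ 8 * m ^ 4 - 6 * α ^ 6 * β ^ 6 -
    2 * α ^ 6 * β ^ 4 * m ^ 2 - 3 * α ^ 6 * β ^ 2 * m ^ 4 + 3 * α ^ 6 * m ^ 6 + α ^ 4 * β ^ 8 -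
    4 * α ^ 4 * β ^ 6 * m ^ 2 + 5 * α ^ 4 * β ^ 4 * m ^ 4 + 2 * α ^ 4 * β ^ 2 * m ^ 6 +
    α ^ 2 * β ^ 10 + α ^ 2 * β ^ 8 * m ^ 2 - α ^ 2 * β ^ 6 * m ^ 4 -
    α ^ 2 * β ^ 4 * m ^ 6) * e ^ 2 + (-6 * α ^ 12 - 22 * α ^ 10 * β ^ 2 + 12 * α ^ 10 * m ^ 2 -
    28 * α ^ 8 * β ^ 4 + 32 * α ^ 8 * β ^ 2 * m ^ 2 - 6 * α ^ 8 * m ^ 4 - 12 * α ^ 6 * β ^ 6 +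
    24 * α ^ 6 * β ^ 4 * m ^ 2 - 10 * α ^ 6 * β ^ 2 * m ^ 4 + 2 * α ^ 4 * β ^ 8 -
    2 * α ^ 4 * β ^ 4 * m ^ 4 + 2 * α ^ 2 * β ^ 10 - 4 * α ^ 2 * β ^ 8 * m ^ 2 +
    2 * α ^ 2 * β ^ 6 * m ^ 4) * e * f + (12 * α ^ 9 * β ^ 2 * m + 32 * α ^ 7 * β ^ 4 * m +
    24 * α ^ 5 * β ^ 6 * m - 12 * α ^ 5 * β ^ 2 * m ^ 5 - 8 * α ^ 3 * β ^ 4 * m ^ 5 -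
    4 * α * β ^ 10 * m + 4 * α * β ^ 6 * m ^ 5) * e * s + (12 * α ^ 10 * β * m +
    32 * α ^ 8 * β ^ 3 * m - 24 * α ^ 8 * β * m ^ 3 + 24 * α ^ 6 * β ^ 5 * m -
    40 * α ^ 6 * β ^ 3 * m ^ 3 + 12 * α ^ 6 * β * m ^ 5 - 8 * α ^ 4 * β ^ 5 * m ^ 3 +
    8 * α ^ 4 * β ^ 3 * m ^ 5 - 4 * α ^ 2 * β ^ 9 * m + 8 * α ^ 2 * β ^ 7 * m ^ 3 -
    4 * α ^ 2 * β ^ 5 * m ^ 5) * e * c + (-3 * α ^ 12 - 11 * α ^ 10 * β ^ 2 + 3 * α ^ 10 * m ^ 2 -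
    14 * α ^ 8 * β ^ 4 + 8 * α ^ 8 * β ^ 2 * m ^ 2 - 6 * α ^ 6 * β ^ 6 + 6 * α ^ 6 * β ^ 4 * m ^ 2
    + α ^ 4 * β ^ 8 + α ^ 2 * β ^ 10 - α ^ 2 * β ^ 8 * m ^ 2) * f ^ 2 + (-12 * α ^ 9 * β ^ 2 * m -
    32 * α ^ 7 * β ^ 4 * m + 12 * α ^ 7 * β ^ 2 * m ^ 3 - 24 * α ^ 5 * β ^ 6 * m +
    20 * α ^ 5 * β ^ 4 * m ^ 3 + 4 * α ^ 3 * β ^ 6 * m ^ 3 + 4 * α * β ^ 10 * m -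
    4 * α * β ^ 8 * m ^ 3) * f * s + (12 * α ^ 10 * β * m + 32 * α ^ 8 * β ^ 3 * m -
    12 * α ^ 8 * β * m ^ 3 + 24 * α ^ 6 * β ^ 5 * m - 20 * α ^ 6 * β ^ 3 * m ^ 3 -
    4 * α ^ 4 * β ^ 5 * m ^ 3 - 4 * α ^ 2 * β ^ 9 * m + 4 * α ^ 2 * β ^ 7 * m ^ 3) * f * c +
    (6 * α ^ 12 + 18 * α ^ 10 * β ^ 2 - 4 * α ^ 10 * m ^ 2 + 24 * α ^ 8 * β ^ 4 -
    4 * α ^ 8 * β ^ 2 * m ^ 2 - 2 * α ^ 8 * m ^ 4 + 36 * α ^ 6 * β ^ 6 + 4 * α ^ 6 * β ^ 4 * m ^ 2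
    + 2 * α ^ 6 * β ^ 2 * m ^ 4 + 54 * α ^ 4 * β ^ 8 + 12 * α ^ 4 * β ^ 6 * m ^ 2 +
    22 * α ^ 4 * β ^ 4 * m ^ 4 + 42 * α ^ 2 * β ^ 10 + 16 * α ^ 2 * β ^ 8 * m ^ 2 +
    14 * α ^ 2 * β ^ 6 * m ^ 4 + 12 * β ^ 12 + 8 * β ^ 10 * m ^ 2 - 4 * β ^ 8 * m ^ 4) * s ^ 2 +
    (8 * α ^ 7 * β ^ 3 * m ^ 2 - 8 * α ^ 5 * β ^ 5 * m ^ 2 - 24 * α ^ 5 * β ^ 3 * m ^ 4 -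
    40 * α ^ 3 * β ^ 7 * m ^ 2 - 16 * α ^ 3 * β ^ 5 * m ^ 4 - 24 * α * β ^ 9 * m ^ 2 +
    8 * α * β ^ 7 * m ^ 4) * s * c + (6 * α ^ 12 + 22 * α ^ 10 * β ^ 2 - 4 * α ^ 10 * m ^ 2 +
    28 * α ^ 8 * β ^ 4 - 20 * α ^ 8 * β ^ 2 * m ^ 2 - 2 * α ^ 8 * m ^ 4 + 12 * α ^ 6 * β ^ 6 -
    20 * α ^ 6 * β ^ 4 * m ^ 2 + 14 * α ^ 6 * β ^ 2 * m ^ 4 - 2 * α ^ 4 * β ^ 8 +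
    4 * α ^ 4 * β ^ 6 * m ^ 2 + 18 * α ^ 4 * β ^ 4 * m ^ 4 - 2 * α ^ 2 * β ^ 10 +
    8 * α ^ 2 * β ^ 8 * m ^ 2 + 2 * α ^ 2 * β ^ 6 * m ^ 4) * c ^ 2 + (-6 * α ^ 12 -
    22 * α ^ 10 * β ^ 2 + 4 * α ^ 10 * m ^ 2 - 28 * α ^ 8 * β ^ 4 + 16 * α ^ 8 * β ^ 2 * m ^ 2 +
    2 * α ^ 8 * m ^ 4 - 12 * α ^ 6 * β ^ 6 + 24 * α ^ 6 * β ^ 4 * m ^ 2 -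
    2 * α ^ 6 * β ^ 2 * m ^ 4 + 2 * α ^ 4 * β ^ 8 + 16 * α ^ 4 * β ^ 6 * m ^ 2 -
    10 * α ^ 4 * β ^ 4 * m ^ 4 + 2 * α ^ 2 * β ^ 10 + 4 * α ^ 2 * β ^ 8 * m ^ 2 -
    6 * α ^ 2 * β ^ 6 * m ^ 4))) * hef +
    (8 * α ^ 2 * β ^ 2 * ((3 * α ^ 12 + 11 * α ^ 10 * β ^ 2 - 5 * α ^ 10 * m ^ 2 +
    14 * α ^ 8 * β ^ 4 - 4 * α ^ 8 * β ^ 2 * m ^ 2 + α ^ 8 * m ^ 4 + 6 * α ^ 6 * β ^ 6 +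
    2 * α ^ 6 * β ^ 4 * m ^ 2 + 11 * α ^ 6 * β ^ 2 * m ^ 4 + α ^ 6 * m ^ 6 - α ^ 4 * β ^ 8 -
    4 * α ^ 4 * β ^ 6 * m ^ 2 + 3 * α ^ 4 * β ^ 4 * m ^ 4 - 2 * α ^ 4 * β ^ 2 * m ^ 6 -
    α ^ 2 * β ^ 10 - 5 * α ^ 2 * β ^ 8 * m ^ 2 - 7 * α ^ 2 * β ^ 6 * m ^ 4 -
    3 * α ^ 2 * β ^ 4 * m ^ 6) * e ^ 2 + (-4 * α ^ 9 * β ^ 2 * m - 8 * α ^ 7 * β ^ 2 * m ^ 3 +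
    24 * α ^ 5 * β ^ 6 * m + 8 * α ^ 5 * β ^ 4 * m ^ 3 - 4 * α ^ 5 * β ^ 2 * m ^ 5 +
    32 * α ^ 3 * β ^ 8 * m + 40 * α ^ 3 * β ^ 6 * m ^ 3 + 8 * α ^ 3 * β ^ 4 * m ^ 5 +
    12 * α * β ^ 10 * m + 24 * α * β ^ 8 * m ^ 3 + 12 * α * β ^ 6 * m ^ 5) * e * s +
    (-4 * α ^ 10 * β * m + 24 * α ^ 6 * β ^ 5 * m + 4 * α ^ 6 * β * m ^ 5 + 32 * α ^ 4 * β ^ 7 * m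
    - 8 * α ^ 4 * β ^ 3 * m ^ 5 + 12 * α ^ 2 * β ^ 9 * m - 12 * α ^ 2 * β ^ 5 * m ^ 5) * e * c +
    (3 * α ^ 12 + 11 * α ^ 10 * β ^ 2 + α ^ 10 * m ^ 2 + 14 * α ^ 8 * β ^ 4 + 6 * α ^ 6 * β ^ 6 -
    6 * α ^ 6 * β ^ 4 * m ^ 2 - α ^ 4 * β ^ 8 - 8 * α ^ 4 * β ^ 6 * m ^ 2 - α ^ 2 * β ^ 10 -
    3 * α ^ 2 * β ^ 8 * m ^ 2) * f ^ 2 + (4 * α ^ 9 * β ^ 2 * m + 4 * α ^ 7 * β ^ 2 * m ^ 3 -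
    24 * α ^ 5 * β ^ 6 * m - 4 * α ^ 5 * β ^ 4 * m ^ 3 - 32 * α ^ 3 * β ^ 8 * m -
    20 * α ^ 3 * β ^ 6 * m ^ 3 - 12 * α * β ^ 10 * m - 12 * α * β ^ 8 * m ^ 3) * f * s +
    (-4 * α ^ 10 * β * m - 4 * α ^ 8 * β * m ^ 3 + 24 * α ^ 6 * β ^ 5 * m +
    4 * α ^ 6 * β ^ 3 * m ^ 3 + 32 * α ^ 4 * β ^ 7 * m + 20 * α ^ 4 * β ^ 5 * m ^ 3 +
    12 * α ^ 2 * β ^ 9 * m + 12 * α ^ 2 * β ^ 7 * m ^ 3) * f * c + (4 * α ^ 10 * β ^ 2 +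
    4 * α ^ 8 * β ^ 4 + 4 * α ^ 8 * β ^ 2 * m ^ 2 - 24 * α ^ 6 * β ^ 6 + 4 * α ^ 6 * β ^ 4 * m ^ 2
    - 56 * α ^ 4 * β ^ 8 - 28 * α ^ 4 * β ^ 6 * m ^ 2 + 4 * α ^ 4 * β ^ 4 * m ^ 4 -
    44 * α ^ 2 * β ^ 10 - 52 * α ^ 2 * β ^ 8 * m ^ 2 - 8 * α ^ 2 * β ^ 6 * m ^ 4 - 12 * β ^ 12 -
    24 * β ^ 10 * m ^ 2 - 12 * β ^ 8 * m ^ 4) * s ^ 2 + (-8 * α ^ 7 * β ^ 3 * m ^ 2 +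
    8 * α ^ 5 * β ^ 5 * m ^ 2 - 8 * α ^ 5 * β ^ 3 * m ^ 4 + 40 * α ^ 3 * β ^ 7 * m ^ 2 +
    16 * α ^ 3 * β ^ 5 * m ^ 4 + 24 * α * β ^ 9 * m ^ 2 + 24 * α * β ^ 7 * m ^ 4) * s * c +
    (4 * α ^ 8 * β ^ 2 * m ^ 2 - 4 * α ^ 6 * β ^ 4 * m ^ 2 + 4 * α ^ 6 * β ^ 2 * m ^ 4 -
    20 * α ^ 4 * β ^ 6 * m ^ 2 - 8 * α ^ 4 * β ^ 4 * m ^ 4 - 12 * α ^ 2 * β ^ 8 * m ^ 2 -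
    12 * α ^ 2 * β ^ 6 * m ^ 4) * c ^ 2 + (6 * α ^ 12 + 22 * α ^ 10 * β ^ 2 - 4 * α ^ 10 * m ^ 2 +
    28 * α ^ 8 * β ^ 4 - 16 * α ^ 8 * β ^ 2 * m ^ 2 - 2 * α ^ 8 * m ^ 4 + 12 * α ^ 6 * β ^ 6 -
    24 * α ^ 6 * β ^ 4 * m ^ 2 + 2 * α ^ 6 * β ^ 2 * m ^ 4 - 2 * α ^ 4 * β ^ 8 -
    16 * α ^ 4 * β ^ 6 * m ^ 2 + 10 * α ^ 4 * β ^ 4 * m ^ 4 - 2 * α ^ 2 * β ^ 10 -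
    4 * α ^ 2 * β ^ 8 * m ^ 2 + 6 * α ^ 2 * β ^ 6 * m ^ 4))) * hsc

/-- The stationary equation before elimination. After division by `(F² + G²)²` the mixed derivatives
occur only as `(2w + m)(4 tauXT - tauSqXT) / (F² + G²)`, where `w` is the profile, which
`mixed_quadratic` evaluates. -/
theorem mixed_stationary (hef : e * f = 1) (hsc : s ^ 2 + c ^ 2 = 1) :
    -mixed (mixedShift α β (mixedShift α β (coeffT α β m))) e f s c * tauSq α β m e f s c
      + 2 * tauSqX α β m e f s c * mixed (mixedShift α β (coeffT α β m)) e f s c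
      - 4 * tauXX α β m e f s c * mixed (coeffT α β m) e f s c
      + 8 * mixed (coeffX α β m) e f s c * tauXT α β m e f s c
      + (m ^ 2 + 2 * (β ^ 2 - α ^ 2)) * mixed (coeffT α β m) e f s c * tauSq α β m e f s c
      + (α ^ 2 + β ^ 2) ^ 2 * mixed (coeffX α β m) e f s c * tauSq α β m e f s c
      - 2 * mixed (coeffX α β m) e f s c * tauSqXT α β m e f s c
      - m * tauSqXT α β m e f s c * tauSq α β m e f s c
      + 4 * m * tauSq α β m e f s c * tauXT α β m e f s c = 0 := by
  simp [tauRe, tauIm, mixed, mixedShift, coeffX, coeffT, tauSq, tauSqX, tauXX, tauXT, tauSqXT]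
  linear_combination (8 * α ^ 2 * β ^ 2 * m * ((-3 * α ^ 12 - 11 * α ^ 10 * β ^ 2 + 9 * α ^ 10 * m ^ 2 -
    14 * α ^ 8 * β ^ 4 + 12 * α ^ 8 * β ^ 2 * m ^ 2 - 9 * α ^ 8 * m ^ 4 - 6 * α ^ 6 * β ^ 6 -
    2 * α ^ 6 * β ^ 4 * m ^ 2 - 3 * α ^ 6 * β ^ 2 * m ^ 4 + 3 * α ^ 6 * m ^ 6 + α ^ 4 * β ^ 8 -
    4 * α ^ 4 * β ^ 6 * m ^ 2 + 5 * α ^ 4 * β ^ 4 * m ^ 4 + 2 * α ^ 4 * β ^ 2 * m ^ 6 +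
    α ^ 2 * β ^ 10 + α ^ 2 * β ^ 8 * m ^ 2 - α ^ 2 * β ^ 6 * m ^ 4 -
    α ^ 2 * β ^ 4 * m ^ 6) * e ^ 2 + (-6 * α ^ 12 - 22 * α ^ 10 * β ^ 2 + 12 * α ^ 10 * m ^ 2 -
    28 * α ^ 8 * β ^ 4 + 32 * α ^ 8 * β ^ 2 * m ^ 2 - 6 * α ^ 8 * m ^ 4 - 12 * α ^ 6 * β ^ 6 +
    24 * α ^ 6 * β ^ 4 * m ^ 2 - 10 * α ^ 6 * β ^ 2 * m ^ 4 + 2 * α ^ 4 * β ^ 8 -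
    2 * α ^ 4 * β ^ 4 * m ^ 4 + 2 * α ^ 2 * β ^ 10 - 4 * α ^ 2 * β ^ 8 * m ^ 2 +
    2 * α ^ 2 * β ^ 6 * m ^ 4) * e * f + (-12 * α ^ 9 * β ^ 2 * m - 32 * α ^ 7 * β ^ 4 * m +
    8 * α ^ 7 * β ^ 2 * m ^ 3 - 24 * α ^ 5 * β ^ 6 * m + 24 * α ^ 5 * β ^ 4 * m ^ 3 -
    12 * α ^ 5 * β ^ 2 * m ^ 5 + 24 * α ^ 3 * β ^ 6 * m ^ 3 - 8 * α ^ 3 * β ^ 4 * m ^ 5 +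
    4 * α * β ^ 10 * m + 8 * α * β ^ 8 * m ^ 3 + 4 * α * β ^ 6 * m ^ 5) * e * s +
    (4 * α ^ 10 * β * m + 32 * α ^ 8 * β ^ 3 * m - 16 * α ^ 8 * β * m ^ 3 + 72 * α ^ 6 * β ^ 5 * m
    - 16 * α ^ 6 * β ^ 3 * m ^ 3 + 12 * α ^ 6 * β * m ^ 5 + 64 * α ^ 4 * β ^ 7 * m +
    16 * α ^ 4 * β ^ 5 * m ^ 3 + 8 * α ^ 4 * β ^ 3 * m ^ 5 + 20 * α ^ 2 * β ^ 9 * m +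
    16 * α ^ 2 * β ^ 7 * m ^ 3 - 4 * α ^ 2 * β ^ 5 * m ^ 5) * e * c + (-3 * α ^ 12 -
    11 * α ^ 10 * β ^ 2 + 3 * α ^ 10 * m ^ 2 - 14 * α ^ 8 * β ^ 4 + 8 * α ^ 8 * β ^ 2 * m ^ 2 -
    6 * α ^ 6 * β ^ 6 + 6 * α ^ 6 * β ^ 4 * m ^ 2 + α ^ 4 * β ^ 8 + α ^ 2 * β ^ 10 -
    α ^ 2 * β ^ 8 * m ^ 2) * f ^ 2 + (12 * α ^ 9 * β ^ 2 * m + 32 * α ^ 7 * β ^ 4 * m +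
    12 * α ^ 7 * β ^ 2 * m ^ 3 + 24 * α ^ 5 * β ^ 6 * m + 20 * α ^ 5 * β ^ 4 * m ^ 3 +
    4 * α ^ 3 * β ^ 6 * m ^ 3 - 4 * α * β ^ 10 * m - 4 * α * β ^ 8 * m ^ 3) * f * s +
    (4 * α ^ 10 * β * m + 32 * α ^ 8 * β ^ 3 * m - 12 * α ^ 8 * β * m ^ 3 + 72 * α ^ 6 * β ^ 5 * m
    - 20 * α ^ 6 * β ^ 3 * m ^ 3 + 64 * α ^ 4 * β ^ 7 * m - 4 * α ^ 4 * β ^ 5 * m ^ 3 +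
    20 * α ^ 2 * β ^ 9 * m + 4 * α ^ 2 * β ^ 7 * m ^ 3) * f * c + (-6 * α ^ 12 -
    34 * α ^ 10 * β ^ 2 + 8 * α ^ 10 * m ^ 2 - 88 * α ^ 8 * β ^ 4 + 12 * α ^ 8 * β ^ 2 * m ^ 2 -
    2 * α ^ 8 * m ^ 4 - 132 * α ^ 6 * β ^ 6 + 20 * α ^ 6 * β ^ 4 * m ^ 2 +
    2 * α ^ 6 * β ^ 2 * m ^ 4 - 118 * α ^ 4 * β ^ 8 + 20 * α ^ 4 * β ^ 6 * m ^ 2 +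
    22 * α ^ 4 * β ^ 4 * m ^ 4 - 58 * α ^ 2 * β ^ 10 - 12 * α ^ 2 * β ^ 8 * m ^ 2 +
    14 * α ^ 2 * β ^ 6 * m ^ 4 - 12 * β ^ 12 - 16 * β ^ 10 * m ^ 2 - 4 * β ^ 8 * m ^ 4) * s ^ 2 +
    (-72 * α ^ 7 * β ^ 3 * m ^ 2 - 120 * α ^ 5 * β ^ 5 * m ^ 2 - 24 * α ^ 5 * β ^ 3 * m ^ 4 -
    24 * α ^ 3 * β ^ 7 * m ^ 2 - 16 * α ^ 3 * β ^ 5 * m ^ 4 + 24 * α * β ^ 9 * m ^ 2 +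
    8 * α * β ^ 7 * m ^ 4) * s * c + (-6 * α ^ 12 - 70 * α ^ 10 * β ^ 2 + 8 * α ^ 10 * m ^ 2 -
    220 * α ^ 8 * β ^ 4 + 36 * α ^ 8 * β ^ 2 * m ^ 2 - 2 * α ^ 8 * m ^ 4 - 300 * α ^ 6 * β ^ 6 +
    12 * α ^ 6 * β ^ 4 * m ^ 2 + 14 * α ^ 6 * β ^ 2 * m ^ 4 - 190 * α ^ 4 * β ^ 8 -
    52 * α ^ 4 * β ^ 6 * m ^ 2 + 18 * α ^ 4 * β ^ 4 * m ^ 4 - 46 * α ^ 2 * β ^ 10 -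
    36 * α ^ 2 * β ^ 8 * m ^ 2 + 2 * α ^ 2 * β ^ 6 * m ^ 4) * c ^ 2 + (6 * α ^ 12 +
    38 * α ^ 10 * β ^ 2 - 8 * α ^ 10 * m ^ 2 + 92 * α ^ 8 * β ^ 4 - 32 * α ^ 8 * β ^ 2 * m ^ 2 +
    2 * α ^ 8 * m ^ 4 + 108 * α ^ 6 * β ^ 6 - 48 * α ^ 6 * β ^ 4 * m ^ 2 -
    2 * α ^ 6 * β ^ 2 * m ^ 4 + 62 * α ^ 4 * β ^ 8 - 32 * α ^ 4 * β ^ 6 * m ^ 2 -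
    10 * α ^ 4 * β ^ 4 * m ^ 4 + 14 * α ^ 2 * β ^ 10 - 8 * α ^ 2 * β ^ 8 * m ^ 2 -
    6 * α ^ 2 * β ^ 6 * m ^ 4))) * hef +
    (8 * α ^ 2 * β ^ 2 * m * ((-3 * α ^ 12 - 3 * α ^ 10 * β ^ 2 + 7 * α ^ 10 * m ^ 2 +
    18 * α ^ 8 * β ^ 4 - 12 * α ^ 8 * β ^ 2 * m ^ 2 - 5 * α ^ 8 * m ^ 4 + 42 * α ^ 6 * β ^ 6 -
    30 * α ^ 6 * β ^ 4 * m ^ 2 + 9 * α ^ 6 * β ^ 2 * m ^ 4 + α ^ 6 * m ^ 6 + 33 * α ^ 4 * β ^ 8 +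
    4 * α ^ 4 * β ^ 6 * m ^ 2 + 17 * α ^ 4 * β ^ 4 * m ^ 4 - 2 * α ^ 4 * β ^ 2 * m ^ 6 +
    9 * α ^ 2 * β ^ 10 + 15 * α ^ 2 * β ^ 8 * m ^ 2 + 3 * α ^ 2 * β ^ 6 * m ^ 4 -
    3 * α ^ 2 * β ^ 4 * m ^ 6) * e ^ 2 + (20 * α ^ 9 * β ^ 2 * m + 64 * α ^ 7 * β ^ 4 * m -
    16 * α ^ 7 * β ^ 2 * m ^ 3 + 72 * α ^ 5 * β ^ 6 * m - 16 * α ^ 5 * β ^ 4 * m ^ 3 -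
    4 * α ^ 5 * β ^ 2 * m ^ 5 + 32 * α ^ 3 * β ^ 8 * m + 16 * α ^ 3 * β ^ 6 * m ^ 3 +
    8 * α ^ 3 * β ^ 4 * m ^ 5 + 4 * α * β ^ 10 * m + 16 * α * β ^ 8 * m ^ 3 +
    12 * α * β ^ 6 * m ^ 5) * e * s + (4 * α ^ 10 * β * m - 8 * α ^ 8 * β * m ^ 3 -
    24 * α ^ 6 * β ^ 5 * m - 24 * α ^ 6 * β ^ 3 * m ^ 3 + 4 * α ^ 6 * β * m ^ 5 -
    32 * α ^ 4 * β ^ 7 * m - 24 * α ^ 4 * β ^ 5 * m ^ 3 - 8 * α ^ 4 * β ^ 3 * m ^ 5 -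
    12 * α ^ 2 * β ^ 9 * m - 8 * α ^ 2 * β ^ 7 * m ^ 3 - 12 * α ^ 2 * β ^ 5 * m ^ 5) * e * c +
    (-3 * α ^ 12 - 3 * α ^ 10 * β ^ 2 + α ^ 10 * m ^ 2 + 18 * α ^ 8 * β ^ 4 + 42 * α ^ 6 * β ^ 6 -
    6 * α ^ 6 * β ^ 4 * m ^ 2 + 33 * α ^ 4 * β ^ 8 - 8 * α ^ 4 * β ^ 6 * m ^ 2 +
    9 * α ^ 2 * β ^ 10 - 3 * α ^ 2 * β ^ 8 * m ^ 2) * f ^ 2 + (-20 * α ^ 9 * β ^ 2 * m -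
    64 * α ^ 7 * β ^ 4 * m + 4 * α ^ 7 * β ^ 2 * m ^ 3 - 72 * α ^ 5 * β ^ 6 * m -
    4 * α ^ 5 * β ^ 4 * m ^ 3 - 32 * α ^ 3 * β ^ 8 * m - 20 * α ^ 3 * β ^ 6 * m ^ 3 -
    4 * α * β ^ 10 * m - 12 * α * β ^ 8 * m ^ 3) * f * s + (4 * α ^ 10 * β * m -
    4 * α ^ 8 * β * m ^ 3 - 24 * α ^ 6 * β ^ 5 * m + 4 * α ^ 6 * β ^ 3 * m ^ 3 -
    32 * α ^ 4 * β ^ 7 * m + 20 * α ^ 4 * β ^ 5 * m ^ 3 - 12 * α ^ 2 * β ^ 9 * m +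
    12 * α ^ 2 * β ^ 7 * m ^ 3) * f * c + (4 * α ^ 10 * β ^ 2 + 4 * α ^ 8 * β ^ 4 +
    4 * α ^ 8 * β ^ 2 * m ^ 2 - 24 * α ^ 6 * β ^ 6 + 4 * α ^ 6 * β ^ 4 * m ^ 2 -
    56 * α ^ 4 * β ^ 8 - 28 * α ^ 4 * β ^ 6 * m ^ 2 + 4 * α ^ 4 * β ^ 4 * m ^ 4 -
    44 * α ^ 2 * β ^ 10 - 52 * α ^ 2 * β ^ 8 * m ^ 2 - 8 * α ^ 2 * β ^ 6 * m ^ 4 - 12 * β ^ 12 -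
    24 * β ^ 10 * m ^ 2 - 12 * β ^ 8 * m ^ 4) * s ^ 2 + (-8 * α ^ 7 * β ^ 3 * m ^ 2 +
    8 * α ^ 5 * β ^ 5 * m ^ 2 - 8 * α ^ 5 * β ^ 3 * m ^ 4 + 40 * α ^ 3 * β ^ 7 * m ^ 2 +
    16 * α ^ 3 * β ^ 5 * m ^ 4 + 24 * α * β ^ 9 * m ^ 2 + 24 * α * β ^ 7 * m ^ 4) * s * c +
    (4 * α ^ 8 * β ^ 2 * m ^ 2 - 4 * α ^ 6 * β ^ 4 * m ^ 2 + 4 * α ^ 6 * β ^ 2 * m ^ 4 -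
    20 * α ^ 4 * β ^ 6 * m ^ 2 - 8 * α ^ 4 * β ^ 4 * m ^ 4 - 12 * α ^ 2 * β ^ 8 * m ^ 2 -
    12 * α ^ 2 * β ^ 6 * m ^ 4) * c ^ 2 + (-6 * α ^ 12 - 38 * α ^ 10 * β ^ 2 + 8 * α ^ 10 * m ^ 2
    - 92 * α ^ 8 * β ^ 4 + 32 * α ^ 8 * β ^ 2 * m ^ 2 - 2 * α ^ 8 * m ^ 4 - 108 * α ^ 6 * β ^ 6 +
    48 * α ^ 6 * β ^ 4 * m ^ 2 + 2 * α ^ 6 * β ^ 2 * m ^ 4 - 62 * α ^ 4 * β ^ 8 +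
    32 * α ^ 4 * β ^ 6 * m ^ 2 + 10 * α ^ 4 * β ^ 4 * m ^ 4 - 14 * α ^ 2 * β ^ 10 +
    8 * α ^ 2 * β ^ 8 * m ^ 2 + 6 * α ^ 2 * β ^ 6 * m ^ 4))) * hsc

end Identities

/-! ### The normalized breather and its derivatives -/

section Profile

variable (α β m : ℝ)

/-- Apply a function of the four modes to the modes with phases `a`, `k`. -/
def modes (Φ : ℝ → ℝ → ℝ → ℝ → ℝ) (a k x : ℝ) : ℝ :=
  Φ (Real.exp (β * (x + k))) (Real.exp (-(β * (x + k)))) (Real.sin (α * (x + a)))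
    (Real.cos (α * (x + a)))

theorem modes_rel (k x a : ℝ) :
    Real.exp (β * (x + k)) * Real.exp (-(β * (x + k))) = 1 ∧
      Real.sin (α * (x + a)) ^ 2 + Real.cos (α * (x + a)) ^ 2 = 1 :=
  ⟨by rw [← Real.exp_add]; simp, Real.sin_sq_add_cos_sq _⟩

theorem hasDerivAt_modes (a k x : ℝ) :
    HasDerivAt (fun x => Real.exp (β * (x + k))) (β * Real.exp (β * (x + k))) x ∧
    HasDerivAt (fun x => Real.exp (-(β * (x + k)))) (-β * Real.exp (-(β * (x + k)))) x ∧
    HasDerivAt (fun x => Real.sin (α * (x + a))) (α * Real.cos (α * (x + a))) x ∧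
    HasDerivAt (fun x => Real.cos (α * (x + a))) (-α * Real.sin (α * (x + a))) x := by
  have h1 : ∀ γ b : ℝ, HasDerivAt (fun x => γ * (x + b)) γ x := fun γ b => by
    simpa using ((hasDerivAt_id x).add_const b).const_mul γ
  refine ⟨?_, ?_, ?_, ?_⟩
  · refine HasDerivAt.congr_deriv ((h1 β k).exp) ?_; ring
  · refine HasDerivAt.congr_deriv ((h1 β k).neg.exp) ?_; simp; ring
  · refine HasDerivAt.congr_deriv ((h1 α a).sin) ?_; ring
  · refine HasDerivAt.congr_deriv ((h1 α a).cos) ?_; ring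

theorem hasDerivAt_tauRe {e f s c : ℝ → ℝ} {e' f' s' c' x : ℝ} (he : HasDerivAt e e' x)
    (hf : HasDerivAt f f' x) (hs : HasDerivAt s s' x) (hc : HasDerivAt c c' x) :
    HasDerivAt (fun x => tauRe α β m (e x) (f x) (s x) (c x)) (tauRe α β m e' f' s' c') x := by
  unfold tauRe
  exact (((he.const_mul _).add (hf.const_mul _)).sub (hc.const_mul _)).add (hs.const_mul _)

theorem hasDerivAt_tauIm {e s : ℝ → ℝ} {e' s' x : ℝ} (he : HasDerivAt e e' x)
    (hs : HasDerivAt s s' x) :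
    HasDerivAt (fun x => tauIm α β m (e x) (s x)) (tauIm α β m e' s') x := by
  unfold tauIm
  exact (hs.const_mul _).sub (he.const_mul _)

theorem hasDerivAt_mixed (v : Fin 5 → ℝ) (a k x : ℝ) :
    HasDerivAt (modes α β (mixed v) a k) (modes α β (mixed (mixedShift α β v)) a k x) x := by
  obtain ⟨he, hf, hs, hc⟩ := hasDerivAt_modes α β a k x
  unfold modes mixed
  refine HasDerivAt.congr_deriv ((((((he.mul hs).const_mul (v 0)).add ((he.mul hc).const_mul (v 1))).add
    ((hf.mul hs).const_mul (v 2))).add ((hf.mul hc).const_mul (v 3))).add_const (v 4)) ?_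
  simp [mixedShift]
  ring

theorem hasDerivAt_tauSq (a k x : ℝ) :
    HasDerivAt (modes α β (tauSq α β m) a k) (modes α β (tauSqX α β m) a k x) x := by
  obtain ⟨he, hf, hs, hc⟩ := hasDerivAt_modes α β a k x
  unfold modes tauSq tauSqX
  refine HasDerivAt.congr_deriv (((hasDerivAt_tauRe α β m he hf hs hc).pow 2).add
    ((hasDerivAt_tauIm α β m he hs).pow 2)) ?_
  push_cast
  ring

theorem hasDerivAt_tauSqX (a k x : ℝ) :
    HasDerivAt (modes α β (tauSqX α β m) a k)
      (m * modes α β (mixed (coeffX α β m)) a k x + 4 * modes α β (tauXX α β m) a k x) x := by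
  obtain ⟨he, hf, hs, hc⟩ := hasDerivAt_modes α β a k x
  obtain ⟨hef, hsc⟩ := modes_rel α β k x a
  have key := tau_bilinear α β m _ _ _ _ hef hsc
  unfold modes tauSqX tauXX
  refine HasDerivAt.congr_deriv ((((hasDerivAt_tauRe α β m he hf hs hc).mul (hasDerivAt_tauRe α β m (he.const_mul β)
    (hf.const_mul (-β)) (hc.const_mul α) (hs.const_mul (-α)))).add
    ((hasDerivAt_tauIm α β m he hs).mul
      (hasDerivAt_tauIm α β m (he.const_mul β) (hc.const_mul α)))).const_mul 2) ?_
  ring_nf at key ⊢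
  linear_combination 2 * key

/-- `∂ₓ log (F² + G²)` -/
def logD (a k x : ℝ) : ℝ := modes α β (tauSqX α β m) a k x / modes α β (tauSq α β m) a k x

/-- The quotient of a form in the mixed modes by `F² + G²`. -/
def quot (v : Fin 5 → ℝ) (a k x : ℝ) : ℝ :=
  modes α β (mixed v) a k x / modes α β (tauSq α β m) a k x

/-- The breather divided by `√2`. -/
def prof (a k x : ℝ) : ℝ := quot α β m (coeffX α β m) a k x

/-- The time derivative of the potential of `prof`. -/
def pot (a k x : ℝ) : ℝ := quot α β m (coeffT α β m) a k x

def pot₁ (a k x : ℝ) : ℝ :=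
  quot α β m (mixedShift α β (coeffT α β m)) a k x - pot α β m a k x * logD α β m a k x

def pot₂ (a k x : ℝ) : ℝ :=
  quot α β m (mixedShift α β (mixedShift α β (coeffT α β m))) a k x
    - 2 * logD α β m a k x * pot₁ α β m a k x - pot α β m a k x * logD α β m a k x ^ 2
    - pot α β m a k x * (prof α β m a k x ^ 2 + m * prof α β m a k x)

def prof₁ (a k x : ℝ) : ℝ :=
  quot α β m (mixedShift α β (coeffX α β m)) a k x - prof α β m a k x * logD α β m a k x

/-- Defined by the integrated Gardner equation instead of the quotient rule, so that the third and
fourth derivatives of the profile come from two derivatives of `pot`. -/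
def prof₂ (a k x : ℝ) : ℝ :=
  -pot α β m a k x - 2 * prof α β m a k x ^ 3 - 3 * m * prof α β m a k x ^ 2

def prof₃ (a k x : ℝ) : ℝ :=
  -pot₁ α β m a k x - 6 * prof α β m a k x ^ 2 * prof₁ α β m a k x
    - 6 * m * (prof α β m a k x * prof₁ α β m a k x)

def prof₄ (a k x : ℝ) : ℝ :=
  -pot₂ α β m a k x - 12 * prof α β m a k x * prof₁ α β m a k x ^ 2
    - 6 * prof α β m a k x ^ 2 * prof₂ α β m a k x
    - 6 * m * (prof₁ α β m a k x ^ 2 + prof α β m a k x * prof₂ α β m a k x)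

variable {α β m}
variable (hD : ∀ a k x : ℝ, modes α β (tauSq α β m) a k x ≠ 0)
include hD

theorem logD_sq_add_prof_sq (a k x : ℝ) :
    logD α β m a k x ^ 2 + prof α β m a k x ^ 2
      = 4 * (modes α β (tauXX α β m) a k x / modes α β (tauSq α β m) a k x) := by
  obtain ⟨hef, hsc⟩ := modes_rel α β k x a
  have h := hD a k x
  have key : modes α β (tauSqX α β m) a k x ^ 2 + modes α β (mixed (coeffX α β m)) a k x ^ 2
    = 4 * modes α β (tauSq α β m) a k x * modes α β (tauXX α β m) a k x :=
    tauSqX_sq α β m _ _ _ _ hef hsc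
  unfold logD prof quot
  field_simp
  linear_combination key

/-- The bilinear equation gives `m w + 4 (Fₓ² + Gₓ²) / (F² + G²)` for the second derivative of `F² +
G²` over itself, `w` being the profile; by Lagrange's identity, subtracting the square of the
logarithmic derivative leaves `w² + m w`. Thus derivatives of quotients close up in `w`, `logD` and
forms in the mixed modes. -/
theorem hasDerivAt_logD (a k x : ℝ) :
    HasDerivAt (logD α β m a k) (prof α β m a k x ^ 2 + m * prof α β m a k x) x := by
  have h := hD a k x
  have key := logD_sq_add_prof_sq hD a k x
  refine HasDerivAt.congr_deriv ((hasDerivAt_tauSqX α β m a k x).div (hasDerivAt_tauSq α β m a k x) h) ?_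
  unfold prof logD quot at *
  field_simp at key ⊢
  linear_combination -key

theorem hasDerivAt_quot (v : Fin 5 → ℝ) (a k x : ℝ) :
    HasDerivAt (quot α β m v a k)
      (quot α β m (mixedShift α β v) a k x - quot α β m v a k x * logD α β m a k x) x := by
  have h := hD a k x
  refine HasDerivAt.congr_deriv ((hasDerivAt_mixed α β v a k x).div (hasDerivAt_tauSq α β m a k x) h) ?_
  unfold logD quot
  field_simp

theorem hasDerivAt_prof (a k x : ℝ) :
    HasDerivAt (prof α β m a k) (prof₁ α β m a k x) x :=
  hasDerivAt_quot hD _ a k x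

theorem hasDerivAt_pot (a k x : ℝ) :
    HasDerivAt (pot α β m a k) (pot₁ α β m a k x) x :=
  hasDerivAt_quot hD _ a k x

theorem hasDerivAt_quot_second (v : Fin 5 → ℝ) (a k x : ℝ) :
    HasDerivAt (fun x => quot α β m (mixedShift α β v) a k x
        - quot α β m v a k x * logD α β m a k x)
      (quot α β m (mixedShift α β (mixedShift α β v)) a k x
        - 2 * logD α β m a k x * (quot α β m (mixedShift α β v) a k x
            - quot α β m v a k x * logD α β m a k x)
        - quot α β m v a k x * logD α β m a k x ^ 2
        - quot α β m v a k x * (prof α β m a k x ^ 2 + m * prof α β m a k x)) x := by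
  refine HasDerivAt.congr_deriv ((hasDerivAt_quot hD (mixedShift α β v) a k x).sub
    ((hasDerivAt_quot hD v a k x).mul (hasDerivAt_logD hD a k x))) ?_
  ring

theorem hasDerivAt_pot₁ (a k x : ℝ) :
    HasDerivAt (pot₁ α β m a k) (pot₂ α β m a k x) x :=
  hasDerivAt_quot_second hD _ a k x

theorem hasDerivAt_prof₁ (a k x : ℝ) :
    HasDerivAt (prof₁ α β m a k) (prof₂ α β m a k x) x := by
  obtain ⟨hef, hsc⟩ := modes_rel α β k x a
  have h := hD a k x
  have key : modes α β (mixed (mixedShift α β (mixedShift α β (coeffX α β m)))) a k x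
        * modes α β (tauSq α β m) a k x
      - 2 * modes α β (tauSqX α β m) a k x
        * modes α β (mixed (mixedShift α β (coeffX α β m))) a k x
      + 4 * modes α β (tauXX α β m) a k x * modes α β (mixed (coeffX α β m)) a k x
      + 2 * m * modes α β (mixed (coeffX α β m)) a k x ^ 2
      + modes α β (mixed (coeffT α β m)) a k x * modes α β (tauSq α β m) a k x = 0 :=
    mixed_evolution α β m _ _ _ _ hef hsc
  have key' : quot α β m (mixedShift α β (mixedShift α β (coeffX α β m))) a k x
      - 2 * logD α β m a k x * quot α β m (mixedShift α β (coeffX α β m)) a k x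
      + 4 * (modes α β (tauXX α β m) a k x / modes α β (tauSq α β m) a k x)
        * quot α β m (coeffX α β m) a k x
      + 2 * m * quot α β m (coeffX α β m) a k x ^ 2 + pot α β m a k x = 0 := by
    unfold quot logD pot quot
    field_simp
    linear_combination key
  rw [← logD_sq_add_prof_sq hD] at key'
  refine HasDerivAt.congr_deriv (hasDerivAt_quot_second hD (coeffX α β m) a k x) ?_
  unfold prof₂ prof at *
  linear_combination key'

theorem hasDerivAt_prof₂ (a k x : ℝ) :
    HasDerivAt (prof₂ α β m a k) (prof₃ α β m a k x) x := by
  have hw := hasDerivAt_prof hD a k x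
  refine HasDerivAt.congr_deriv (((hasDerivAt_pot hD a k x).neg.sub ((hw.pow 3).const_mul 2)).sub
    ((hw.pow 2).const_mul (3 * m))) ?_
  unfold prof₃
  push_cast
  ring

theorem hasDerivAt_prof₃ (a k x : ℝ) :
    HasDerivAt (prof₃ α β m a k) (prof₄ α β m a k x) x := by
  have hw := hasDerivAt_prof hD a k x
  have hw1 := hasDerivAt_prof₁ hD a k x
  refine HasDerivAt.congr_deriv (((hasDerivAt_pot₁ hD a k x).neg.sub (((hw.pow 2).const_mul 6).mul hw1)).sub
    ((hw.mul hw1).const_mul (6 * m))) ?_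
  unfold prof₄
  rw [Pi.pow_apply]
  push_cast
  ring

/-- The normalized breather solves a stationary fourth-order equation. -/
theorem prof_stationary (a k x : ℝ) :
    prof₄ α β m a k x
      - 2 * (β ^ 2 - α ^ 2) * (prof₂ α β m a k x + 3 * m * prof α β m a k x ^ 2
          + 2 * prof α β m a k x ^ 3)
      + (α ^ 2 + β ^ 2) ^ 2 * prof α β m a k x
      + 10 * prof α β m a k x * prof₁ α β m a k x ^ 2
      + 10 * prof α β m a k x ^ 2 * prof₂ α β m a k x + 6 * prof α β m a k x ^ 5
      + 5 * m * prof₁ α β m a k x ^ 2 + 10 * m * prof α β m a k x * prof₂ α β m a k x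
      + 10 * m ^ 2 * prof α β m a k x ^ 3 + 15 * m * prof α β m a k x ^ 4 = 0 := by
  obtain ⟨hef, hsc⟩ := modes_rel α β k x a
  have h := hD a k x
  have hY := logD_sq_add_prof_sq hD a k x
  -- The quotient rule and the Gardner equation both give the derivative of `prof₁`; comparing them
  -- expresses the twice shifted quotient of `coeffX` through the profile.
  have hB := (hasDerivAt_prof₁ hD a k x).unique (hasDerivAt_quot_second hD (coeffX α β m) a k x)
  have hC : quot α β m (mixedShift α β (coeffX α β m)) a k x ^ 2
      - prof α β m a k x * quot α β m (mixedShift α β (mixedShift α β (coeffX α β m))) a k x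
      - modes α β (tauSqXT α β m) a k x / modes α β (tauSq α β m) a k x
      + 4 * (modes α β (tauXT α β m) a k x / modes α β (tauSq α β m) a k x)
      + m * pot α β m a k x = 0 := by
    have key := mixed_quadratic α β m _ _ _ _ hef hsc
    change modes α β (mixed (mixedShift α β (coeffX α β m))) a k x ^ 2
      - modes α β (mixed (coeffX α β m)) a k x
        * modes α β (mixed (mixedShift α β (mixedShift α β (coeffX α β m)))) a k x
      - modes α β (tauSqXT α β m) a k x * modes α β (tauSq α β m) a k x
      + 4 * modes α β (tauSq α β m) a k x * modes α β (tauXT α β m) a k x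
      + m * modes α β (tauSq α β m) a k x * modes α β (mixed (coeffT α β m)) a k x = 0 at key
    unfold prof pot quot
    field_simp
    linear_combination key
  have hZ : -quot α β m (mixedShift α β (mixedShift α β (coeffT α β m))) a k x
      + 2 * logD α β m a k x * quot α β m (mixedShift α β (coeffT α β m)) a k x
      - 4 * (modes α β (tauXX α β m) a k x / modes α β (tauSq α β m) a k x) * pot α β m a k x
      + 8 * prof α β m a k x
        * (modes α β (tauXT α β m) a k x / modes α β (tauSq α β m) a k x)
      + (m ^ 2 + 2 * (β ^ 2 - α ^ 2)) * pot α β m a k x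
      + (α ^ 2 + β ^ 2) ^ 2 * prof α β m a k x
      - 2 * prof α β m a k x
        * (modes α β (tauSqXT α β m) a k x / modes α β (tauSq α β m) a k x)
      - m * (modes α β (tauSqXT α β m) a k x / modes α β (tauSq α β m) a k x)
      + 4 * m * (modes α β (tauXT α β m) a k x / modes α β (tauSq α β m) a k x) = 0 := by
    have key := mixed_stationary α β m _ _ _ _ hef hsc
    change -modes α β (mixed (mixedShift α β (mixedShift α β (coeffT α β m)))) a k x
        * modes α β (tauSq α β m) a k x
      + 2 * modes α β (tauSqX α β m) a k x
        * modes α β (mixed (mixedShift α β (coeffT α β m))) a k x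
      - 4 * modes α β (tauXX α β m) a k x * modes α β (mixed (coeffT α β m)) a k x
      + 8 * modes α β (mixed (coeffX α β m)) a k x * modes α β (tauXT α β m) a k x
      + (m ^ 2 + 2 * (β ^ 2 - α ^ 2)) * modes α β (mixed (coeffT α β m)) a k x
        * modes α β (tauSq α β m) a k x
      + (α ^ 2 + β ^ 2) ^ 2 * modes α β (mixed (coeffX α β m)) a k x
        * modes α β (tauSq α β m) a k x
      - 2 * modes α β (mixed (coeffX α β m)) a k x * modes α β (tauSqXT α β m) a k x
      - m * modes α β (tauSqXT α β m) a k x * modes α β (tauSq α β m) a k x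
      + 4 * m * modes α β (tauSq α β m) a k x * modes α β (tauXT α β m) a k x = 0 at key
    unfold prof pot quot logD
    field_simp
    linear_combination key
  rw [mul_div_assoc'] at hY
  have hq : quot α β m (mixedShift α β (coeffX α β m)) a k x
    = prof₁ α β m a k x + prof α β m a k x * logD α β m a k x := by unfold prof₁; ring
  have hq2 : quot α β m (mixedShift α β (mixedShift α β (coeffX α β m))) a k x
    = prof₂ α β m a k x + 2 * logD α β m a k x * prof₁ α β m a k x
      + prof α β m a k x * logD α β m a k x ^ 2
      + prof α β m a k x * (prof α β m a k x ^ 2 + m * prof α β m a k x) := by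
    rw [hB]; unfold prof₁ prof; ring
  rw [hq, hq2] at hC
  have hq3 : quot α β m (mixedShift α β (coeffT α β m)) a k x
    = pot₁ α β m a k x + pot α β m a k x * logD α β m a k x := by unfold pot₁; ring
  have hq4 : quot α β m (mixedShift α β (mixedShift α β (coeffT α β m))) a k x
    = pot₂ α β m a k x + 2 * logD α β m a k x * pot₁ α β m a k x
      + pot α β m a k x * logD α β m a k x ^ 2
      + pot α β m a k x * (prof α β m a k x ^ 2 + m * prof α β m a k x) := by
    unfold pot₂; ring
  rw [hq3, hq4] at hZ
  have h2 : prof₂ α β m a k x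
    = -pot α β m a k x - 2 * prof α β m a k x ^ 3 - 3 * m * prof α β m a k x ^ 2 := rfl
  unfold prof₄
  rw [h2] at hC ⊢
  -- The multiple of `hC` cancels the mixed derivatives `4 tauXT - tauSqXT`, and that of `hY`
  -- replaces `Fₓ² + Gₓ²`.
  linear_combination hZ - (2 * prof α β m a k x + m) * hC - pot α β m a k x * hY

end Profile

/-! ### Uniform decay of the profile -/

section Decay

open Asymptotics Filter

variable {α β m : ℝ}

/-- One fixed linear combination of `F` and `G` already dominates `cosh`, and Cauchy-Schwarz bounds
it by `F² + G²`. The phases never enter the constant. -/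
theorem cosh_sq_le_tauSq (hα : α ≠ 0) (hΔ : 0 < α ^ 2 + β ^ 2 - m ^ 2) :
    ∃ C > 0, ∀ a k x : ℝ,
      C * Real.cosh (β * (x + k)) ^ 2 ≤ modes α β (tauSq α β m) a k x := by
  set R := α ^ 2 + β ^ 2 with hR
  have hR0 : 0 < R := by positivity
  -- With this slope the `sin` terms of `F - κ G` cancel.
  set κ := m * β / R with hκ
  refine ⟨α ^ 2 * (R - m ^ 2) ^ 2 / (1 + κ ^ 2), by positivity, fun a k x => ?_⟩
  obtain ⟨hef, hsc⟩ := modes_rel α β k x a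
  rw [Real.cosh_eq]
  unfold modes
  have he0 := Real.exp_pos (β * (x + k))
  have hf0 := Real.exp_pos (-(β * (x + k)))
  set e := Real.exp (β * (x + k))
  set f := Real.exp (-(β * (x + k)))
  set s := Real.sin (α * (x + a))
  set c := Real.cos (α * (x + a))
  set L := (R - m ^ 2 + 2 * m ^ 2 * β ^ 2 / R) * e + R * f - 2 * m * β * c with hL
  have hcomb : tauRe α β m e f s c - κ * tauIm α β m e s = α * L := by
    rw [hL, hκ]
    unfold tauRe tauIm
    rw [← hR]
    field_simp
    ring
  -- By AM-GM and `e f = 1`, the extra part of the `e` coefficient and half of the `f` coefficient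
  -- absorb the `cos` term of `L`; what is left dominates `(R - m²)(e + f)/2`.
  have hamgm : 2 * |m * β| ≤ 2 * m ^ 2 * β ^ 2 / R * e + R / 2 * f := by
    refine abs_le_of_sq_le_sq' ?_ (by positivity) |>.2
    have h1 : (2 * |m * β|) ^ 2 = 4 * ((2 * m ^ 2 * β ^ 2 / R * e) * (R / 2 * f)) := by
      rw [mul_pow, sq_abs]
      field_simp
      linear_combination (-4 * m ^ 2 * β ^ 2) * hef
    rw [h1]
    nlinarith [sq_nonneg (2 * m ^ 2 * β ^ 2 / R * e - R / 2 * f)]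
  have hc1 : |c| ≤ 1 := Real.abs_cos_le_one _
  have hmc : m * β * c ≤ |m * β| :=
    (le_abs_self _).trans (by rw [abs_mul]; exact mul_le_of_le_one_right (abs_nonneg _) hc1)
  have hL1 : (R - m ^ 2) * ((e + f) / 2) ≤ L := by
    have h3 : L = (2 * m ^ 2 * β ^ 2 / R * e + R / 2 * f) + (R - m ^ 2) * e + R / 2 * f
        - 2 * (m * β * c) := by rw [hL]; ring
    rw [h3]
    nlinarith [mul_pos hΔ he0, mul_nonneg (sq_nonneg m) hf0.le]
  have hL0 : 0 ≤ (R - m ^ 2) * ((e + f) / 2) := by positivity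
  have hL2 : ((R - m ^ 2) * ((e + f) / 2)) ^ 2 ≤ L ^ 2 := pow_le_pow_left₀ hL0 hL1 2
  have hcs : (tauRe α β m e f s c - κ * tauIm α β m e s) ^ 2
      ≤ (1 + κ ^ 2) * tauSq α β m e f s c := by
    unfold tauSq
    nlinarith [sq_nonneg (κ * tauRe α β m e f s c + tauIm α β m e s)]
  rw [hcomb] at hcs
  rw [div_mul_eq_mul_div, div_le_iff₀ (by positivity)]
  nlinarith [mul_le_mul_of_nonneg_left hL2 (sq_nonneg α)]

/-- The weight `cosh (β (x + k))` as a function of `(a, k, x)`. -/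
def wt (β : ℝ) (q : ℝ × ℝ × ℝ) : ℝ := Real.cosh (β * (q.2.2 + q.2.1))

/-- Uncurry a function of `(a, k, x)`. -/
def unc (g : ℝ → ℝ → ℝ → ℝ) (q : ℝ × ℝ × ℝ) : ℝ := g q.1 q.2.1 q.2.2

theorem one_isBigO_wt (β : ℝ) : (fun _ => (1 : ℝ)) =O[⊤] wt β := by
  refine isBigO_top.2 ⟨1, fun q => ?_⟩
  have := Real.one_le_cosh (β * (q.2.2 + q.2.1))
  rw [norm_one, one_mul, Real.norm_eq_abs]
  exact this.trans (le_abs_self _)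

theorem exp_isBigO_wt (β : ℝ) :
    (fun q : ℝ × ℝ × ℝ => Real.exp (β * (q.2.2 + q.2.1))) =O[⊤] wt β ∧
    (fun q : ℝ × ℝ × ℝ => Real.exp (-(β * (q.2.2 + q.2.1)))) =O[⊤] wt β := by
  constructor <;>
  · refine isBigO_top.2 ⟨2, fun q => ?_⟩
    have h1 := Real.exp_pos (β * (q.2.2 + q.2.1))
    have h2 := Real.exp_pos (-(β * (q.2.2 + q.2.1)))
    unfold wt
    rw [Real.norm_of_nonneg (by positivity), Real.norm_of_nonneg (by positivity), Real.cosh_eq]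
    linarith

theorem trig_isBigO_one (α : ℝ) :
    (fun q : ℝ × ℝ × ℝ => Real.sin (α * (q.2.2 + q.1))) =O[⊤] (fun _ => (1 : ℝ)) ∧
    (fun q : ℝ × ℝ × ℝ => Real.cos (α * (q.2.2 + q.1))) =O[⊤] (fun _ => (1 : ℝ)) := by
  constructor
  · exact isBigO_top.2 ⟨1, fun q => by simpa using Real.abs_sin_le_one _⟩
  · exact isBigO_top.2 ⟨1, fun q => by simpa using Real.abs_cos_le_one _⟩

theorem mixed_isBigO (v : Fin 5 → ℝ) : unc (modes α β (mixed v)) =O[⊤] wt β := by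
  obtain ⟨he, hf⟩ := exp_isBigO_wt β
  obtain ⟨hs, hc⟩ := trig_isBigO_one α
  have h := (((((he.mul hs).const_mul_left (v 0)).add ((he.mul hc).const_mul_left (v 1))).add
    ((hf.mul hs).const_mul_left (v 2))).add ((hf.mul hc).const_mul_left (v 3))).add
    (((one_isBigO_wt β).mul (isBigO_refl (fun _ => (1 : ℝ)) ⊤)).const_mul_left (v 4))
  simpa [unc, modes, mixed, Function.comp_def] using h

theorem tauSqX_isBigO : unc (modes α β (tauSqX α β m)) =O[⊤] fun q => wt β q ^ 2 := by
  obtain ⟨he, hf⟩ := exp_isBigO_wt β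
  obtain ⟨hs, hc⟩ := trig_isBigO_one α
  replace hs := hs.trans (one_isBigO_wt β)
  replace hc := hc.trans (one_isBigO_wt β)
  have hre : ∀ {e f s c : ℝ × ℝ × ℝ → ℝ}, e =O[⊤] wt β → f =O[⊤] wt β → s =O[⊤] wt β →
      c =O[⊤] wt β → (fun q => tauRe α β m (e q) (f q) (s q) (c q)) =O[⊤] wt β :=
    fun h1 h2 h3 h4 => (((h1.const_mul_left _).add (h2.const_mul_left _)).sub
      (h4.const_mul_left _)).add (h3.const_mul_left _)
  have him : ∀ {e s : ℝ × ℝ × ℝ → ℝ}, e =O[⊤] wt β → s =O[⊤] wt β →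
      (fun q => tauIm α β m (e q) (s q)) =O[⊤] wt β :=
    fun h1 h3 => (h3.const_mul_left _).sub (h1.const_mul_left _)
  have h := (((hre he hf hs hc).mul (hre (he.const_mul_left β) (hf.const_mul_left (-β))
    (hc.const_mul_left α) (hs.const_mul_left (-α)))).add
    ((him he hs).mul (him (he.const_mul_left β) (hc.const_mul_left α)))).const_mul_left 2
  exact (h.congr_left fun q => rfl).congr_right fun q => (pow_two _).symm

variable (hα : α ≠ 0) (hΔ : 0 < α ^ 2 + β ^ 2 - m ^ 2)
include hα hΔ

theorem tauSq_ne_zero (a k x : ℝ) : modes α β (tauSq α β m) a k x ≠ 0 := by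
  obtain ⟨C, hC, h⟩ := cosh_sq_le_tauSq hα hΔ
  have := Real.cosh_pos (β * (x + k))
  exact (lt_of_lt_of_le (by positivity) (h a k x)).ne'

theorem tauSq_inv_isBigO :
    (fun q => (unc (modes α β (tauSq α β m)) q)⁻¹) =O[⊤] fun q => (wt β q ^ 2)⁻¹ := by
  obtain ⟨C, hC, h⟩ := cosh_sq_le_tauSq hα hΔ
  refine isBigO_top.2 ⟨C⁻¹, fun q => ?_⟩
  have h0 : 0 < wt β q := Real.cosh_pos _
  have h1 : C * wt β q ^ 2 ≤ unc (modes α β (tauSq α β m)) q := h _ _ _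
  have h2 : 0 < C * wt β q ^ 2 := by positivity
  rw [Real.norm_of_nonneg (inv_nonneg.2 (h2.le.trans h1)), Real.norm_of_nonneg (by positivity),
    ← mul_inv]
  exact inv_anti₀ h2 h1

theorem quot_isBigO (v : Fin 5 → ℝ) :
    unc (quot α β m v) =O[⊤] fun q => (wt β q)⁻¹ := by
  refine ((mixed_isBigO v).mul (tauSq_inv_isBigO hα hΔ)).congr_right fun q => ?_
  have h0 : wt β q ≠ 0 := (Real.cosh_pos _).ne'
  field_simp

theorem logD_isBigO : unc (logD α β m) =O[⊤] fun _ => (1 : ℝ) := by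
  refine (tauSqX_isBigO.mul (tauSq_inv_isBigO hα hΔ)).congr_right fun q => ?_
  have h0 : wt β q ≠ 0 := (Real.cosh_pos _).ne'
  field_simp

/-- The filter `⊤` on triples `(a, k, x)` makes each bound global, with one constant for all phases.
Every summand has one factor `O(1/cosh)` and otherwise bounded ones. -/
theorem prof_isBigO :
    unc (prof α β m) =O[⊤] (fun q => (wt β q)⁻¹) ∧
    unc (prof₁ α β m) =O[⊤] (fun q => (wt β q)⁻¹) ∧
    unc (prof₂ α β m) =O[⊤] (fun q => (wt β q)⁻¹) ∧
    unc (prof₃ α β m) =O[⊤] (fun q => (wt β q)⁻¹) ∧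
    unc (prof₄ α β m) =O[⊤] (fun q => (wt β q)⁻¹) := by
  have hL := logD_isBigO hα hΔ
  have hH : (fun q => (wt β q)⁻¹) =O[⊤] fun _ => (1 : ℝ) :=
    isBigO_top.2 ⟨1, fun q => by
      have h1 : 1 ≤ wt β q := Real.one_le_cosh _
      rw [Real.norm_of_nonneg (by positivity), norm_one, one_mul]
      exact inv_le_one_of_one_le₀ h1⟩
  have mulB : ∀ {f g : ℝ × ℝ × ℝ → ℝ}, f =O[⊤] (fun q => (wt β q)⁻¹) →
      g =O[⊤] (fun _ => (1 : ℝ)) → (fun q => f q * g q) =O[⊤] fun q => (wt β q)⁻¹ :=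
    fun hf hg => (hf.mul hg).congr_right fun q => mul_one _
  have sq1 : ∀ {g : ℝ × ℝ × ℝ → ℝ}, g =O[⊤] (fun _ => (1 : ℝ)) →
      (fun q => g q ^ 2) =O[⊤] (fun _ => (1 : ℝ)) :=
    fun hg => (hg.pow 2).congr_right fun q => one_pow 2
  have w0 : unc (prof α β m) =O[⊤] (fun q => (wt β q)⁻¹) := quot_isBigO hα hΔ _
  have p0 : unc (pot α β m) =O[⊤] (fun q => (wt β q)⁻¹) := quot_isBigO hα hΔ _
  have w0' := w0.trans hH
  have w1 : unc (prof₁ α β m) =O[⊤] (fun q => (wt β q)⁻¹) :=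
    (quot_isBigO hα hΔ _).sub (mulB w0 hL)
  have p1 : unc (pot₁ α β m) =O[⊤] (fun q => (wt β q)⁻¹) :=
    (quot_isBigO hα hΔ _).sub (mulB p0 hL)
  have w1' := w1.trans hH
  have p2 : unc (pot₂ α β m) =O[⊤] (fun q => (wt β q)⁻¹) := by
    refine (((quot_isBigO hα hΔ (mixedShift α β (mixedShift α β (coeffT α β m)))).sub
      ((mulB p1 hL).const_mul_left 2)).sub (mulB p0 (sq1 hL))).sub
      (mulB p0 ((sq1 w0').add (w0'.const_mul_left m))) |>.congr_left fun q => ?_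
    simp only [unc, pot₂]; ring
  have w2 : unc (prof₂ α β m) =O[⊤] (fun q => (wt β q)⁻¹) := by
    refine ((p0.neg_left.sub ((mulB w0 (sq1 w0')).const_mul_left 2)).sub
      ((mulB w0 w0').const_mul_left (3 * m))).congr_left fun q => ?_
    simp only [unc, prof₂]; ring
  have w3 : unc (prof₃ α β m) =O[⊤] (fun q => (wt β q)⁻¹) := by
    refine ((p1.neg_left.sub ((mulB w1 (sq1 w0')).const_mul_left 6)).sub
      ((mulB w0 w1').const_mul_left (6 * m))).congr_left fun q => ?_
    simp only [unc, prof₃]; ring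
  have w4 : unc (prof₄ α β m) =O[⊤] (fun q => (wt β q)⁻¹) := by
    refine (((p2.neg_left.sub ((mulB w0 (sq1 w1')).const_mul_left 12)).sub
      ((mulB w2 (sq1 w0')).const_mul_left 6)).sub
      (((mulB w1 w1').add (mulB w2 w0')).const_mul_left (6 * m))).congr_left fun q => ?_
    simp only [unc, prof₄]; ring
  exact ⟨w0, w1, w2, w3, w4⟩

end Decay

/-! ### Square-integrability, and return from the profile to the breather -/

theorem memLp_of_le_inv_cosh {β : ℝ} (hβ : β ≠ 0) {v : ℝ → ℝ} (hv : Continuous v) {C k : ℝ}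
    (h : ∀ x, |v x| ≤ C * (Real.cosh (β * (x + k)))⁻¹) : MemLp v 2 (volume : Measure ℝ) := by
  -- A polynomial bound suffices: of the two factors `1/cosh` in the square, one is bounded by `1`
  -- and the other by a multiple of `1/(1 + y²)`.
  have hcosh : ∀ y : ℝ, (1 + y ^ 2) / 4 ≤ Real.cosh y := fun y => by
    have h1 := Real.quadratic_le_exp_of_nonneg (abs_nonneg y)
    have h2 : Real.exp |y| ≤ 2 * Real.cosh y := by
      rw [← Real.cosh_abs, Real.cosh_eq]
      have := Real.exp_pos (-|y|)
      linarith
    rw [sq_abs] at h1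
    nlinarith [abs_nonneg y]
  have hint : Integrable (fun x : ℝ => 4 * C ^ 2 * (1 + (β * (x + k)) ^ 2)⁻¹) := by
    have h1 := (integrable_inv_one_add_sq.comp_mul_left' hβ).comp_add_right k
    exact h1.const_mul _
  rw [memLp_two_iff_integrable_sq hv.aestronglyMeasurable]
  refine hint.mono' (hv.pow 2).aestronglyMeasurable (ae_of_all _ fun x => ?_)
  have h1 := Real.one_le_cosh (β * (x + k))
  have h2 := hcosh (β * (x + k))
  set H := Real.cosh (β * (x + k))
  set Y := 1 + (β * (x + k)) ^ 2 with hY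
  have hY0 : 0 < Y := by positivity
  rw [Real.norm_of_nonneg (sq_nonneg _), ← sq_abs]
  calc |v x| ^ 2 ≤ (C * H⁻¹) ^ 2 := pow_le_pow_left₀ (abs_nonneg _) (h x) 2
    _ = C ^ 2 * (H⁻¹ * H⁻¹) := by ring
    _ ≤ C ^ 2 * (H⁻¹ * 1) := by
        have : H⁻¹ ≤ 1 := inv_le_one_of_one_le₀ h1
        have : 0 < H⁻¹ := by positivity
        gcongr
    _ ≤ C ^ 2 * (4 * Y⁻¹) := by
        have : H⁻¹ ≤ (Y / 4)⁻¹ := inv_anti₀ (by positivity) h2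
        rw [inv_div, div_eq_mul_inv] at this
        rw [mul_one]
        gcongr
    _ = 4 * C ^ 2 * Y⁻¹ := by ring

/-- The breather is `√2` times the normalized profile with suitable phases. -/
theorem breather_eq_prof {α β μ : ℝ} (hα : α ≠ 0) (hβ : β ≠ 0) (hΔ : 0 < Del α β μ)
    (x₁ x₂ t : ℝ) : ∃ a k : ℝ, ∀ x, breather α β μ x₁ x₂ t x = √2 * prof α β (√2 * μ) a k x := by
  have hρ : 0 < α ^ 2 + β ^ 2 := by positivity
  have hr2 : √(α ^ 2 + β ^ 2) ^ 2 = α ^ 2 + β ^ 2 := Real.sq_sqrt hρ.le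
  have hd2 : √(Del α β μ) ^ 2 = Del α β μ := Real.sq_sqrt hΔ.le
  have hr : 0 < √(α ^ 2 + β ^ 2) := Real.sqrt_pos.2 hρ
  have hd : 0 < √(Del α β μ) := Real.sqrt_pos.2 hΔ
  have hm2 : (√2 * μ) ^ 2 = 2 * μ ^ 2 := by rw [mul_pow, Real.sq_sqrt (by norm_num)]
  set r := √(α ^ 2 + β ^ 2) with hrdef
  set d := √(Del α β μ) with hddef
  set m := √2 * μ with hm
  set a := (α ^ 2 - 3 * β ^ 2) * t + x₁ with ha
  -- The shift by `log (r/d) / β` turns `exp(βy₂)` into `d/r` times the mode; after multiplication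
  -- by `2αrd` all coefficients are polynomial in `α, β, m`.
  set k := (3 * α ^ 2 - β ^ 2) * t + x₂ + Real.log (r / d) / β with hk
  have hy1 : ∀ x, yOne α β x₁ t x = x + a := fun x => by unfold yOne; rw [ha]; ring
  have hy2 : ∀ x, β * yTwo α β x₂ t x = β * (x + k) - Real.log (r / d) := fun x => by
    unfold yTwo; rw [hk]; field_simp; ring
  have hexp : ∀ x, Real.exp (β * yTwo α β x₂ t x) = d / r * Real.exp (β * (x + k)) := fun x => by
    rw [hy2, Real.exp_sub, Real.exp_log (by positivity)]; field_simp
  have hexp' : ∀ x, Real.exp (-(β * yTwo α β x₂ t x)) = r / d * Real.exp (-(β * (x + k))) :=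
    fun x => by
    rw [hy2, neg_sub, sub_eq_add_neg, Real.exp_add, Real.exp_log (by positivity)]
  have hd2' : d ^ 2 = α ^ 2 + β ^ 2 - m ^ 2 := by rw [hd2, hm2]; rfl
  have hF : breatherF α β μ x₁ x₂ t
      = fun x => (2 * α * r * d)⁻¹ * modes α β (tauRe α β m) a k x := by
    funext x
    unfold breatherF modes tauRe
    rw [← hrdef, ← hddef, ← hd2', ← hr2, Real.cosh_eq, hexp, hexp', hy1, ← hm]
    field_simp
    ring
  have hG : breatherG α β μ x₁ x₂ t
      = fun x => (2 * α * r * d)⁻¹ * modes α β (fun e _ s _ => tauIm α β m e s) a k x := by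
    funext x
    unfold breatherG modes tauIm
    rw [Real.cosh_add_sinh, ← hrdef, ← hddef, ← hr2, ← hd2, hexp, hy1, ← hm]
    field_simp
  refine ⟨a, k, fun x => ?_⟩
  obtain ⟨he, hf, hs, hc⟩ := hasDerivAt_modes α β a k x
  obtain ⟨hef, hsc⟩ := modes_rel α β k x a
  have key := tau_wronskian α β m _ _ _ _ hef hsc
  have hF1 := ((hasDerivAt_tauRe α β m he hf hs hc).const_mul (2 * α * r * d)⁻¹).deriv
  have hG1 := ((hasDerivAt_tauIm α β m he hs).const_mul (2 * α * r * d)⁻¹).deriv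
  unfold breather prof quot
  rw [hF, hG]
  unfold modes at *
  rw [hF1, hG1, ← key]
  unfold tauSq
  field_simp

/-- The breather is smooth and solves a stationary fourth-order equation; its derivatives are
square-integrable, and bounded uniformly in time and phases. -/
theorem exists_breather_derivs {α β μ : ℝ} (hα : α ≠ 0) (hβ : β ≠ 0) (hΔ : 0 < Del α β μ) :
    ∃ C : ℝ, ∀ x₁ x₂ t : ℝ, ∃ D : Fin 5 → ℝ → ℝ, D 0 = breather α β μ x₁ x₂ t ∧
      (∀ (i : Fin 4) x, HasDerivAt (D i.castSucc) (D i.succ x) x) ∧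
      (∀ i x, |D i x| ≤ C) ∧ (∀ i, MemLp (D i) 2 (volume : Measure ℝ)) ∧ (∀ i, Continuous (D i)) ∧
      ∀ x, D 4 x - 2 * (β ^ 2 - α ^ 2) * (D 2 x + 3 * μ * D 0 x ^ 2 + D 0 x ^ 3)
        + (α ^ 2 + β ^ 2) ^ 2 * D 0 x + 5 * D 0 x * D 1 x ^ 2 + 5 * D 0 x ^ 2 * D 2 x
        + 3 / 2 * D 0 x ^ 5 + 5 * μ * D 1 x ^ 2 + 10 * μ * D 0 x * D 2 x
        + 10 * μ ^ 2 * D 0 x ^ 3 + 15 / 2 * μ * D 0 x ^ 4 = 0 := by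
  set m := √2 * μ with hm
  have h2 : √2 ^ 2 = 2 := Real.sq_sqrt (by norm_num)
  have hΔ' : 0 < α ^ 2 + β ^ 2 - m ^ 2 := by
    rw [hm, mul_pow, h2]; exact hΔ
  have hD := tauSq_ne_zero hα hΔ'
  set P : Fin 5 → ℝ → ℝ → ℝ → ℝ :=
    ![prof α β m, prof₁ α β m, prof₂ α β m, prof₃ α β m, prof₄ α β m] with hP
  have hbound : ∃ C : ℝ, 0 ≤ C ∧ ∀ i a k x, |P i a k x| ≤ C * (Real.cosh (β * (x + k)))⁻¹ := by
    have hO : ∀ i, ∃ C, ∀ a k x, |P i a k x| ≤ C * (Real.cosh (β * (x + k)))⁻¹ := by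
      obtain ⟨w0, w1, w2, w3, w4⟩ := prof_isBigO hα hΔ'
      have conv : ∀ {g : ℝ → ℝ → ℝ → ℝ}, Asymptotics.IsBigO ⊤ (unc g) (fun q => (wt β q)⁻¹) →
          ∃ C, ∀ a k x, |g a k x| ≤ C * (Real.cosh (β * (x + k)))⁻¹ := fun hg => by
        obtain ⟨C, hC⟩ := Asymptotics.isBigO_top.1 hg
        refine ⟨C, fun a k x => ?_⟩
        have h := hC (a, k, x)
        have h0 : 0 < wt β (a, k, x) := Real.cosh_pos _
        rw [Real.norm_eq_abs, Real.norm_of_nonneg (inv_nonneg.2 h0.le)] at h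
        exact h
      intro i
      fin_cases i
      exacts [conv w0, conv w1, conv w2, conv w3, conv w4]
    choose C hC using hO
    refine ⟨∑ i, |C i|, by positivity, fun i a k x => (hC i a k x).trans ?_⟩
    have := Real.cosh_pos (β * (x + k))
    gcongr
    exact (le_abs_self _).trans (Finset.single_le_sum (f := fun i => |C i|)
      (fun _ _ => abs_nonneg _) (Finset.mem_univ i))
  obtain ⟨C, hC0, hC⟩ := hbound
  have hder : ∀ (i : Fin 4) a k x, HasDerivAt (P i.castSucc a k) (P i.succ a k x) x := by
    intro i a k x
    fin_cases i
    exacts [hasDerivAt_prof hD a k x, hasDerivAt_prof₁ hD a k x, hasDerivAt_prof₂ hD a k x,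
      hasDerivAt_prof₃ hD a k x]
  have hcont : ∀ i a k, Continuous (P i a k) := by
    intro i a k
    have hcast : ∀ i : Fin 4, Continuous (P i.castSucc a k) := fun i =>
      continuous_iff_continuousAt.2 fun x => (hder i a k x).continuousAt
    refine Fin.lastCases ?_ hcast i
    -- The last function is not itself differentiated, so its continuity is read off the stationary
    -- equation, which gives it in terms of lower derivatives.
    have hstat : P (Fin.last 4) a k = fun x => -(- 2 * (β ^ 2 - α ^ 2)
          * (P 2 a k x + 3 * m * P 0 a k x ^ 2 + 2 * P 0 a k x ^ 3)
        + (α ^ 2 + β ^ 2) ^ 2 * P 0 a k x + 10 * P 0 a k x * P 1 a k x ^ 2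
        + 10 * P 0 a k x ^ 2 * P 2 a k x + 6 * P 0 a k x ^ 5 + 5 * m * P 1 a k x ^ 2
        + 10 * m * P 0 a k x * P 2 a k x + 10 * m ^ 2 * P 0 a k x ^ 3
        + 15 * m * P 0 a k x ^ 4) := by
      funext x
      have h := prof_stationary hD a k x
      change prof₄ α β m a k x = -(- 2 * (β ^ 2 - α ^ 2)
        * (prof₂ α β m a k x + 3 * m * prof α β m a k x ^ 2 + 2 * prof α β m a k x ^ 3)
        + (α ^ 2 + β ^ 2) ^ 2 * prof α β m a k x + 10 * prof α β m a k x * prof₁ α β m a k x ^ 2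
        + 10 * prof α β m a k x ^ 2 * prof₂ α β m a k x + 6 * prof α β m a k x ^ 5
        + 5 * m * prof₁ α β m a k x ^ 2
        + 10 * m * prof α β m a k x * prof₂ α β m a k x + 10 * m ^ 2 * prof α β m a k x ^ 3
        + 15 * m * prof α β m a k x ^ 4)
      linear_combination h
    have c0 : Continuous (P 0 a k) := hcast 0
    have c1 : Continuous (P 1 a k) := hcast 1
    have c2 : Continuous (P 2 a k) := hcast 2
    rw [hstat]
    fun_prop
  refine ⟨√2 * C, fun x₁ x₂ t => ?_⟩
  obtain ⟨a, k, hak⟩ := breather_eq_prof hα hβ hΔ x₁ x₂ t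
  refine ⟨fun i x => √2 * P i a k x, (funext hak).symm, fun i x => (hder i a k x).const_mul _,
    fun i x => ?_, fun i => ?_, fun i => continuous_const.mul (hcont i a k), fun x => ?_⟩
  · rw [abs_mul, abs_of_pos (by positivity : (0 : ℝ) < √2)]
    gcongr
    refine (hC i a k x).trans (mul_le_of_le_one_right hC0 ?_)
    exact inv_le_one_of_one_le₀ (Real.one_le_cosh _)
  · exact (memLp_of_le_inv_cosh hβ (hcont i a k) (hC i a k)).const_mul _
  · have h := prof_stationary hD a k x
    change √2 * prof₄ α β m a k x - 2 * (β ^ 2 - α ^ 2) * (√2 * prof₂ α β m a k x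
        + 3 * μ * (√2 * prof α β m a k x) ^ 2 + (√2 * prof α β m a k x) ^ 3)
      + (α ^ 2 + β ^ 2) ^ 2 * (√2 * prof α β m a k x)
      + 5 * (√2 * prof α β m a k x) * (√2 * prof₁ α β m a k x) ^ 2
      + 5 * (√2 * prof α β m a k x) ^ 2 * (√2 * prof₂ α β m a k x)
      + 3 / 2 * (√2 * prof α β m a k x) ^ 5 + 5 * μ * (√2 * prof₁ α β m a k x) ^ 2
      + 10 * μ * (√2 * prof α β m a k x) * (√2 * prof₂ α β m a k x)
      + 10 * μ ^ 2 * (√2 * prof α β m a k x) ^ 3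
      + 15 / 2 * μ * (√2 * prof α β m a k x) ^ 4 = 0
    have h3 : √2 ^ 3 = 2 * √2 := by rw [pow_succ, h2]
    have h4 : √2 ^ 4 = 4 := by rw [show (4 : ℕ) = 2 * 2 from rfl, pow_mul, h2]; norm_num
    have h5 : √2 ^ 5 = 4 * √2 := by rw [pow_succ, h4]
    simp only [mul_pow, h2, h3, h4, h5]
    rw [hm] at h
    rw [hm]
    simp only [mul_pow, h2] at h
    grind

/-! ### Primitives of locally integrable functions -/

section Primitive

open Set Filter Topology

/-- `F` is a primitive of the locally integrable function `f`. -/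
def IsPrimitive (F f : ℝ → ℝ) : Prop :=
  LocallyIntegrable f volume ∧ ∀ a b, ∫ x in a..b, f x = F b - F a

namespace IsPrimitive

variable {F G f g : ℝ → ℝ}

theorem intervalIntegrable (h : IsPrimitive F f) (a b : ℝ) : IntervalIntegrable f volume a b :=
  (h.1.integrableOn_isCompact isCompact_uIcc).intervalIntegrable

theorem eq_add (h : IsPrimitive F f) (a : ℝ) : F = fun x => F a + ∫ t in a..x, f t := by
  funext x
  rw [h.2]
  ring

theorem absolutelyContinuous (h : IsPrimitive F f) (a b : ℝ) :
    AbsolutelyContinuousOnInterval F a b := by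
  rw [h.eq_add a]
  have hc : AbsolutelyContinuousOnInterval (fun _ : ℝ => F a) a b :=
    ((LipschitzWith.const (F a)).lipschitzOnWith (s := uIcc a b)).absolutelyContinuousOnInterval
  exact hc.add
    ((h.intervalIntegrable a b).absolutelyContinuousOnInterval_intervalIntegral left_mem_uIcc)

theorem continuous (h : IsPrimitive F f) : Continuous F := by
  rw [h.eq_add 0]
  exact continuous_const.add (intervalIntegral.continuous_primitive h.intervalIntegrable 0)

theorem ae_hasDerivAt (h : IsPrimitive F f) : ∀ᵐ x, HasDerivAt F (f x) x := by
  filter_upwards [LocallyIntegrable.ae_hasDerivAt_integral h.1] with x hx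
  rw [h.eq_add 0]
  exact (hx 0).const_add _

/-- Both primitives are absolutely continuous on bounded intervals, so integration by parts applies,
and their derivatives agree almost everywhere with `f` and `g`. -/
theorem mul (hF : IsPrimitive F f) (hG : IsPrimitive G g) :
    IsPrimitive (fun x => F x * G x) (fun x => f x * G x + F x * g x) := by
  refine ⟨?_, fun a b => ?_⟩
  · have h1 : LocallyIntegrable (fun x => f x * G x) volume :=
      (locallyIntegrable_iff.2 fun K hK =>
        (hF.1.integrableOn_isCompact hK).mul_continuousOn hG.continuous.continuousOn hK)
    have h2 : LocallyIntegrable (fun x => F x * g x) volume :=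
      (locallyIntegrable_iff.2 fun K hK =>
        (hG.1.integrableOn_isCompact hK).continuousOn_mul hF.continuous.continuousOn hK)
    exact h1.add h2
  · rw [← (hF.absolutelyContinuous a b).integral_deriv_mul_eq_sub (hG.absolutelyContinuous a b)]
    refine intervalIntegral.integral_congr_ae ?_
    filter_upwards [hF.ae_hasDerivAt, hG.ae_hasDerivAt] with x h1 h2 _
    rw [h1.deriv, h2.deriv]

theorem of_hasDerivAt (h : ∀ x, HasDerivAt F (f x) x) (hf : Continuous f) : IsPrimitive F f :=
  ⟨hf.locallyIntegrable, fun a b =>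
    intervalIntegral.integral_eq_sub_of_hasDerivAt (fun x _ => h x) (hf.intervalIntegrable a b)⟩

/-- An integrable function with an integrable derivative: the derivative has mean zero. -/
theorem integral_eq_zero (h : IsPrimitive F f) (hF : Integrable F) (hf : Integrable f) :
    ∫ x, f x = 0 := by
  have htop : Tendsto F atTop (𝓝 (F 0 + ∫ t in Ioi 0, f t)) := by
    have := (intervalIntegral_tendsto_integral_Ioi (0 : ℝ) hf.integrableOn tendsto_id).const_add
      (F 0)
    rw [h.eq_add 0]
    simpa using this
  have hbot : Tendsto F atBot (𝓝 (F 0 - ∫ t in Iic 0, f t)) := by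
    have := (intervalIntegral_tendsto_integral_Iic (0 : ℝ) hf.integrableOn tendsto_id).const_sub
      (F 0)
    refine this.congr fun x => ?_
    rw [h.2]
    simp
  -- A limit at infinity of an integrable function is zero, because every neighbourhood of infinity
  -- has infinite measure.
  have h1 : F 0 + ∫ t in Ioi 0, f t = 0 := by
    refine IntegrableAtFilter.eq_zero_of_tendsto ⟨univ, univ_mem, hF.integrableOn⟩ ?_ htop
    intro s hs
    obtain ⟨b, hb⟩ := mem_atTop_sets.1 hs
    rw [← top_le_iff, ← Real.volume_Ici (a := b)]
    exact measure_mono hb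
  have h2 : F 0 - ∫ t in Iic 0, f t = 0 := by
    refine IntegrableAtFilter.eq_zero_of_tendsto ⟨univ, univ_mem, hF.integrableOn⟩ ?_ hbot
    intro s hs
    obtain ⟨b, hb⟩ := mem_atBot_sets.1 hs
    rw [← top_le_iff, ← Real.volume_Iic (a := b)]
    exact measure_mono hb
  rw [← intervalIntegral.integral_Iic_add_Ioi (b := (0 : ℝ)) hf.integrableOn hf.integrableOn]
  linarith

theorem isWeakDeriv (h : IsPrimitive F f) : IsWeakDeriv F f := by
  intro φ hφ hc
  have hφ1 : IsPrimitive φ (deriv φ) := of_hasDerivAt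
    (fun x => (hφ.differentiable (by simp) x).hasDerivAt) (hφ.continuous_deriv (by simp))
  have i1 : Integrable (fun x => f x * φ x) := by
    simpa using h.1.integrable_smul_right_of_hasCompactSupport hφ.continuous hc
  have i2 : Integrable (fun x => F x * deriv φ x) :=
    (h.continuous.mul (hφ.continuous_deriv (by simp))).integrable_of_hasCompactSupport
      (hc.deriv.mul_left)
  have i3 : Integrable (fun x => F x * φ x) :=
    (h.continuous.mul hφ.continuous).integrable_of_hasCompactSupport hc.mul_left
  have := (h.mul hφ1).integral_eq_zero i3 (i1.add i2)
  rw [integral_add i1 i2] at this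
  linarith

end IsPrimitive

/-! ### Weak derivatives -/

theorem IsWeakDeriv.congr {f g f' g' : ℝ → ℝ} (h : IsWeakDeriv f g) (hf : f =ᵐ[volume] f')
    (hg : g =ᵐ[volume] g') : IsWeakDeriv f' g' := by
  intro φ h1 h2
  have e1 : ∫ x, f' x * deriv φ x = ∫ x, f x * deriv φ x :=
    integral_congr_ae (by filter_upwards [hf] with x hx; rw [hx])
  have e2 : ∫ x, g' x * φ x = ∫ x, g x * φ x :=
    integral_congr_ae (by filter_upwards [hg] with x hx; rw [hx])
  rw [e1, e2]
  exact h φ h1 h2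

theorem IsWeakDeriv.ae_unique {f g g' : ℝ → ℝ} (h : IsWeakDeriv f g) (h' : IsWeakDeriv f g')
    (hg : LocallyIntegrable g volume) (hg' : LocallyIntegrable g' volume) : g =ᵐ[volume] g' := by
  refine ae_eq_of_integral_contDiff_smul_eq hg hg' fun φ h1 h2 => ?_
  have e := h φ h1 h2
  rw [h' φ h1 h2, neg_inj] at e
  simpa only [smul_eq_mul, mul_comm] using e.symm

/-- A smooth compactly supported function with mean zero is the derivative of one. -/
theorem exists_primitive_of_integral_eq_zero {χ : ℝ → ℝ} (h1 : ContDiff ℝ ∞ χ)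
    (h2 : HasCompactSupport χ) (h3 : ∫ x, χ x = 0) :
    ∃ φ : ℝ → ℝ, ContDiff ℝ ∞ φ ∧ HasCompactSupport φ ∧ deriv φ = χ := by
  obtain ⟨A, hA0, hA⟩ := h2.isCompact.isBounded.subset_closedBall_lt 0 (0 : ℝ)
  have hz : ∀ x, x ∉ Icc (-A) A → χ x = 0 := fun x hx => by
    by_contra hne
    have := hA (subset_tsupport _ hne)
    rw [Real.closedBall_eq_Icc] at this
    simp only [zero_sub, zero_add] at this
    exact hx this
  -- The base point lies strictly to the left of the support, so the half-open interval `(-(A + 1),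
  -- x]` contains the whole support once `x > A + 1`.
  have hd : ∀ x, HasDerivAt (fun x => ∫ t in (-(A + 1))..x, χ t) (χ x) x := fun x =>
    intervalIntegral.integral_hasDerivAt_right (h1.continuous.intervalIntegrable _ _)
      (h1.continuous.stronglyMeasurableAtFilter _ _) h1.continuous.continuousAt
  have hder : deriv (fun x => ∫ t in (-(A + 1))..x, χ t) = χ := funext fun x => (hd x).deriv
  refine ⟨fun x => ∫ t in (-(A + 1))..x, χ t, ?_, ?_, hder⟩
  · rw [contDiff_infty_iff_deriv, hder]
    exact ⟨fun x => (hd x).differentiableAt, h1⟩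
  · refine HasCompactSupport.intro (isCompact_Icc (a := -(A + 1)) (b := A + 1)) fun x hx => ?_
    rcases lt_or_ge x (-(A + 1)) with hlt | hge
    · rw [intervalIntegral.integral_symm, neg_eq_zero]
      refine intervalIntegral.integral_zero_ae (ae_of_all _ fun t ht => hz t fun hmem => ?_)
      rw [uIoc_of_le hlt.le] at ht
      linarith [ht.2, hmem.1]
    · have hx' : A + 1 < x := by
        by_contra hcon
        exact hx ⟨hge, not_lt.1 hcon⟩
      rw [← h3]
      refine intervalIntegral.integral_eq_integral_of_support_subset fun t ht => ?_
      have hmem : t ∈ Icc (-A) A := by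
        by_contra hcon
        exact ht (hz t hcon)
      exact ⟨by linarith [hmem.1], by linarith [hmem.2]⟩

/-- A locally integrable function whose weak derivative vanishes is constant. -/
theorem IsWeakDeriv.ae_const {f : ℝ → ℝ} (hf : LocallyIntegrable f volume)
    (h : IsWeakDeriv f 0) : ∃ c, f =ᵐ[volume] fun _ => c := by
  let ρ : ContDiffBump (0 : ℝ) := ⟨1, 2, one_pos, one_lt_two⟩
  have hρ1 : ContDiff ℝ ∞ (ρ.normed volume) := ρ.contDiff_normed
  have hρ2 : HasCompactSupport (ρ.normed volume) := ρ.hasCompactSupport_normed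
  have hρ3 : ∫ x, ρ.normed volume x = 1 := ρ.integral_normed
  have hint : ∀ ψ : ℝ → ℝ, Continuous ψ → HasCompactSupport ψ →
      Integrable (fun x => f x * ψ x) := fun ψ c1 c2 => by
    simpa using hf.integrable_smul_right_of_hasCompactSupport c1 c2
  -- For a test function `ψ`, the difference `ψ - (∫ψ) ρ` has mean zero and so is the derivative of
  -- a test function. Testing `f` against it gives `∫ fψ = (∫ψ)(∫ fρ)`, which identifies the
  -- constant.
  refine ⟨∫ x, f x * ρ.normed volume x,
    ae_eq_of_integral_contDiff_smul_eq hf (locallyIntegrable_const _) fun ψ h1 h2 => ?_⟩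
  have iψ : Integrable ψ := h1.continuous.integrable_of_hasCompactSupport h2
  have iρ : Integrable (ρ.normed volume) := hρ1.continuous.integrable_of_hasCompactSupport hρ2
  have c2 : HasCompactSupport (fun x => (∫ y, ψ y) * ρ.normed volume x) := hρ2.mul_left
  obtain ⟨φ, p1, p2, p3⟩ := exists_primitive_of_integral_eq_zero
    (χ := fun x => ψ x - (∫ y, ψ y) * ρ.normed volume x) (h1.sub (contDiff_const.mul hρ1))
    (h2.sub c2) (by rw [integral_sub iψ (iρ.const_mul _), integral_const_mul, hρ3]; ring)
  have e := h φ p1 p2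
  rw [p3] at e
  have e2 : ∫ x, f x * (ψ x - (∫ y, ψ y) * ρ.normed volume x)
      = (∫ x, f x * ψ x) - (∫ y, ψ y) * ∫ x, f x * ρ.normed volume x := by
    rw [← integral_const_mul, ← integral_sub (hint ψ h1.continuous h2)
      ((hint _ hρ1.continuous hρ2).const_mul _)]
    congr 1
    funext x
    ring
  rw [e2] at e
  simp only [Pi.zero_apply, zero_mul, integral_zero, neg_zero] at e
  simp only [smul_eq_mul]
  rw [integral_mul_const]
  simp only [mul_comm (ψ _)]
  linarith

/-- A function with a locally integrable weak derivative has a locally absolutely continuous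
representative. -/
theorem IsWeakDeriv.exists_isPrimitive {f g : ℝ → ℝ} (h : IsWeakDeriv f g)
    (hf : LocallyIntegrable f volume) (hg : LocallyIntegrable g volume) :
    ∃ F, f =ᵐ[volume] F ∧ IsPrimitive F g := by
  have hI : ∀ a b, IntervalIntegrable g volume a b := fun a b =>
    (hg.integrableOn_isCompact isCompact_uIcc).intervalIntegrable
  have hG : IsPrimitive (fun x => ∫ t in (0 : ℝ)..x, g t) g :=
    ⟨hg, fun a b => (intervalIntegral.integral_interval_sub_left (hI 0 b) (hI 0 a)).symm⟩
  have hGl := hG.continuous.locallyIntegrable (μ := volume)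
  -- The primitive of `g` has weak derivative `g` as well, so `f` minus it has weak derivative zero.
  obtain ⟨c, hc⟩ := IsWeakDeriv.ae_const (f := fun x => f x - ∫ t in (0 : ℝ)..x, g t)
    (hf.sub hGl) fun φ h1 h2 => by
      have i1 : Integrable (fun x => f x * deriv φ x) := by
        simpa using hf.integrable_smul_right_of_hasCompactSupport (h1.continuous_deriv (by simp))
          h2.deriv
      have i2 : Integrable (fun x => (∫ t in (0 : ℝ)..x, g t) * deriv φ x) := by
        simpa using hGl.integrable_smul_right_of_hasCompactSupport (h1.continuous_deriv (by simp))
          h2.deriv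
      simp only [sub_mul]
      rw [integral_sub i1 i2, h φ h1 h2, hG.isWeakDeriv φ h1 h2]
      simp
  refine ⟨fun x => c + ∫ t in (0 : ℝ)..x, g t, ?_, hg, fun a b => ?_⟩
  · filter_upwards [hc] with x hx
    rw [← hx]
    ring
  · rw [hG.2 a b]
    ring

/-- The Leibniz rule in integrated form, for two functions in `H¹` and a bounded smooth weight. -/
theorem integral_leibniz {f f' g g' v v' : ℝ → ℝ} (hf : MemLp f 2 volume)
    (hf' : MemLp f' 2 volume) (hg : MemLp g 2 volume) (hg' : MemLp g' 2 volume)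
    (hff : IsWeakDeriv f f') (hgg : IsWeakDeriv g g') (hv : ∀ x, HasDerivAt v (v' x) x)
    (hvc : Continuous v') {C : ℝ} (hb : ∀ x, |v x| ≤ C) (hb' : ∀ x, |v' x| ≤ C) :
    Integrable (fun x => v' x * (f x * g x) + v x * (f' x * g x) + v x * (f x * g' x)) ∧
      ∫ x, (v' x * (f x * g x) + v x * (f' x * g x) + v x * (f x * g' x)) = 0 := by
  have hloc : ∀ {u : ℝ → ℝ}, MemLp u 2 volume → LocallyIntegrable u volume := fun hu =>
    hu.locallyIntegrable (by norm_num)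
  obtain ⟨F, hF, pF⟩ := hff.exists_isPrimitive (hloc hf) (hloc hf')
  obtain ⟨G, hG, pG⟩ := hgg.exists_isPrimitive (hloc hg) (hloc hg')
  have pV := IsPrimitive.of_hasDerivAt hv hvc
  have key := pV.mul (pF.mul pG)
  have hFm := hf.ae_eq hF
  have hGm := hg.ae_eq hG
  have wt : ∀ {u w : ℝ → ℝ}, Integrable u → Continuous w → (∀ x, |w x| ≤ C) →
      Integrable (fun x => w x * u x) := fun hu hw hC =>
    hu.bdd_mul hw.aestronglyMeasurable (ae_of_all _ hC)
  have j1 := wt (hFm.integrable_mul hGm) pV.continuous hb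
  have j2 := wt (hFm.integrable_mul hGm) hvc hb'
  have j3 := wt ((hf'.integrable_mul hGm).add (hFm.integrable_mul hg')) pV.continuous hb
  have hae : (fun x => v' x * (f x * g x) + v x * (f' x * g x) + v x * (f x * g' x)) =ᵐ[volume]
      fun x => v' x * (F x * G x) + v x * (f' x * G x + F x * g' x) := by
    filter_upwards [hF, hG] with x h1 h2
    rw [h1, h2]
    ring
  exact ⟨(j2.add j3).congr hae.symm,
    (integral_congr_ae hae).trans (key.integral_eq_zero j1 (j2.add j3))⟩

/-- The Sobolev embedding of `H¹(ℝ)` into the bounded functions. -/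
theorem ae_abs_le_of_isWeakDeriv {f g : ℝ → ℝ} (hf : MemLp f 2 volume) (hg : MemLp g 2 volume)
    (h : IsWeakDeriv f g) {A : ℝ} (hA : 0 ≤ A) (hfA : ∫ x, f x ^ 2 ≤ A ^ 2)
    (hgA : ∫ x, g x ^ 2 ≤ A ^ 2) : ∀ᵐ x, |f x| ≤ 2 * A := by
  have hloc : ∀ {u : ℝ → ℝ}, MemLp u 2 volume → LocallyIntegrable u volume := fun hu =>
    hu.locallyIntegrable (by norm_num)
  obtain ⟨F, hF, pF⟩ := h.exists_isPrimitive (hloc hf) (hloc hg)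
  filter_upwards [hF] with x hx
  have hFm := hf.ae_eq hF
  -- Cauchy-Schwarz on the unit interval
  have cs : ∀ {u : ℝ → ℝ}, MemLp u 2 volume → ∫ t, u t ^ 2 ≤ A ^ 2 →
      ∫ t in x..x + 1, |u t| ≤ A := by
    intro u hu hA2
    have i2 := hu.integrable_sq
    have iabs : IntervalIntegrable (fun t => |u t|) volume x (x + 1) :=
      (((hloc hu).integrableOn_isCompact isCompact_uIcc).intervalIntegrable).abs
    have isq : IntervalIntegrable (fun t => u t ^ 2) volume x (x + 1) := i2.intervalIntegrable
    have hle : ∫ t in x..x + 1, u t ^ 2 ≤ A ^ 2 := by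
      rw [intervalIntegral.integral_of_le (by linarith)]
      exact (setIntegral_le_integral i2 (ae_of_all _ fun t => sq_nonneg _)).trans hA2
    set I := ∫ t in x..x + 1, |u t| with hI
    -- The interval has length one, so `I` is the mean of `|u|`, and nonnegativity of the variance
    -- is Cauchy-Schwarz.
    have hvar : 0 ≤ ∫ t in x..x + 1, (|u t| - I) ^ 2 :=
      intervalIntegral.integral_nonneg (by linarith) fun t _ => sq_nonneg _
    have hexp : ∫ t in x..x + 1, (|u t| - I) ^ 2 = (∫ t in x..x + 1, u t ^ 2) - I ^ 2 := by
      have e : ∀ t, (|u t| - I) ^ 2 = u t ^ 2 - 2 * I * |u t| + I ^ 2 := fun t => by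
        rw [sub_sq, sq_abs]; ring
      simp only [e]
      rw [intervalIntegral.integral_add (isq.sub (iabs.const_mul _)) (by simp),
        intervalIntegral.integral_sub isq (iabs.const_mul _),
        intervalIntegral.integral_const_mul, ← hI]
      simp
      ring
    exact abs_le_of_sq_le_sq' (by linarith) hA |>.2
  have ig := pF.intervalIntegrable x (x + 1)
  have iF := (pF.continuous.abs.intervalIntegrable (μ := volume) x (x + 1))
  have hpt : ∀ y ∈ Icc x (x + 1), |F x| ≤ |F y| + A := by
    intro y hy
    have e : F x = F y - ∫ t in x..y, g t := by rw [pF.2]; ring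
    have e2 : |∫ t in x..y, g t| ≤ A := by
      refine (intervalIntegral.abs_integral_le_integral_abs hy.1).trans
        (le_trans ?_ (cs hg hgA))
      refine intervalIntegral.integral_mono_interval le_rfl hy.1 hy.2
        (ae_of_all _ fun t => abs_nonneg _) ig.abs
    rw [e]
    exact (abs_sub _ _).trans (by linarith)
  -- Averaging the pointwise bound over the unit interval: the mean of `|F|` gives one `A`, the
  -- oscillation of `F` the other.
  have h1 : ∫ t in x..x + 1, |F x| ≤ ∫ t in x..x + 1, (|F t| + A) :=
    intervalIntegral.integral_mono_on (by linarith) (by simp) (iF.add (by simp)) hpt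
  rw [intervalIntegral.integral_add iF (by simp)] at h1
  simp only [intervalIntegral.integral_const, add_sub_cancel_left, one_smul] at h1
  have h2 : ∫ t, F t ^ 2 ≤ A ^ 2 := by
    refine le_of_eq_of_le (integral_congr_ae ?_) hfA
    filter_upwards [hF] with t ht
    rw [ht]
  rw [hx]
  linarith [cs hFm h2]

end Primitive

/-! ### Elements of the Sobolev spaces -/

theorem Sobolev.memLp_der {k : ℕ} (w : Sobolev k) (j : Fin (k + 1)) :
    MemLp (Sobolev.der w j) 2 volume := Lp.memLp _

theorem Sobolev.integral_der_sq_le {k : ℕ} (w : Sobolev k) (j : Fin (k + 1)) :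
    ∫ x, Sobolev.der w j x ^ 2 ≤ ‖w‖ ^ 2 := by
  have h1 : ∫ x, Sobolev.der w j x ^ 2 = ‖w.1 j‖ ^ 2 := by
    rw [← real_inner_self_eq_norm_sq, L2.inner_def]
    refine integral_congr_ae (ae_of_all _ fun x => ?_)
    simp only [Sobolev.der, RCLike.inner_apply, conj_trivial]
    ring
  rw [h1]
  exact pow_le_pow_left₀ (norm_nonneg _) (PiLp.norm_apply_le w.1 j) 2

theorem Sobolev.der_add {k : ℕ} (w z : Sobolev k) (j : Fin (k + 1)) :
    Sobolev.der (w + z) j =ᵐ[volume] fun x => Sobolev.der w j x + Sobolev.der z j x :=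
  Lp.coeFn_add (w.1 j) (z.1 j)

theorem Sobolev.ae_abs_der_zero_le (w : Sobolev 2) :
    ∀ᵐ x, |Sobolev.der w 0 x| ≤ 2 * ‖w‖ :=
  ae_abs_le_of_isWeakDeriv (Sobolev.memLp_der w 0) (Sobolev.memLp_der w 1) (w.2 0) (norm_nonneg _)
    (Sobolev.integral_der_sq_le w 0) (Sobolev.integral_der_sq_le w 1)

theorem integrable_weight {w f g : ℝ → ℝ} {C : ℝ} (hw : AEStronglyMeasurable w volume)
    (hC : ∀ᵐ x, |w x| ≤ C) (hf : MemLp f 2 volume) (hg : MemLp g 2 volume) :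
    Integrable (fun x => w x * (f x * g x)) :=
  (hf.integrable_mul hg).bdd_mul hw hC

theorem integral_sum_const_mul {n : ℕ} (c : Fin n → ℝ) {f : Fin n → ℝ → ℝ}
    (h : ∀ i, Integrable (f i)) :
    Integrable (fun x => ∑ i, c i * f i x) ∧
      ∫ x, ∑ i, c i * f i x = ∑ i, c i * ∫ x, f i x := by
  refine ⟨integrable_finsetSum _ fun i _ => (h i).const_mul _, ?_⟩
  rw [integral_finsetSum _ fun i _ => (h i).const_mul _]
  simp only [integral_const_mul]

/-! ### The Lyapunov functional and its second variation as integrals of densities -/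

/-- The density of the Lyapunov functional. -/
def lyapunovDensity (α β μ p₀ p₁ p₂ : ℝ) : ℝ :=
  1 / 2 * p₂ ^ 2 - 5 * μ * (p₀ * p₁ ^ 2) + 5 / 2 * μ ^ 2 * p₀ ^ 4 - 5 / 2 * (p₀ ^ 2 * p₁ ^ 2)
    + 3 / 2 * μ * p₀ ^ 5 + 1 / 4 * p₀ ^ 6
    + 2 * (β ^ 2 - α ^ 2) * (1 / 2 * p₁ ^ 2 - μ * p₀ ^ 3 - 1 / 4 * p₀ ^ 4)
    + (α ^ 2 + β ^ 2) ^ 2 * (1 / 2 * p₀ ^ 2)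

/-- Every monomial of degree at least three is a product of two square-integrable factors and a
power of `w`, which is bounded by the Sobolev embedding. Hence all integrals converge and may be
combined. -/
theorem lyapunov_eq_integral (α β μ : ℝ) (w : Sobolev 2) :
    Integrable (fun x => lyapunovDensity α β μ (Sobolev.der w 0 x) (Sobolev.der w 1 x)
      (Sobolev.der w 2 x)) ∧
    lyapunov α β μ w = ∫ x, lyapunovDensity α β μ (Sobolev.der w 0 x) (Sobolev.der w 1 x)
      (Sobolev.der w 2 x) := by
  have m0 := Sobolev.memLp_der w 0
  have m1 := Sobolev.memLp_der w 1
  have m2 := Sobolev.memLp_der w 2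
  have hb : ∀ n : ℕ, ∀ᵐ x, |Sobolev.der w 0 x ^ n| ≤ (2 * ‖w‖) ^ n := fun n => by
    filter_upwards [Sobolev.ae_abs_der_zero_le w] with x hx
    rw [abs_pow]
    exact pow_le_pow_left₀ (abs_nonneg _) hx n
  have hm : ∀ n : ℕ, AEStronglyMeasurable (fun x => Sobolev.der w 0 x ^ n) volume :=
    fun n => m0.aestronglyMeasurable.pow n
  have i0 : ∀ n : ℕ, Integrable (fun x => Sobolev.der w 0 x ^ (n + 2)) := fun n => by
    refine (integrable_weight (hm n) (hb n) m0 m0).congr (ae_of_all _ fun x => ?_)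
    ring
  have i1 : ∀ n : ℕ, Integrable (fun x => Sobolev.der w 0 x ^ n * Sobolev.der w 1 x ^ 2) :=
    fun n => by
    refine (integrable_weight (hm n) (hb n) m1 m1).congr (ae_of_all _ fun x => ?_)
    ring
  obtain ⟨h1, h2⟩ := integral_sum_const_mul
    ![1 / 2, -5 * μ, 5 / 2 * μ ^ 2 - 2 * (β ^ 2 - α ^ 2) * (1 / 4), -5 / 2, 3 / 2 * μ, 1 / 4,
      β ^ 2 - α ^ 2, -2 * (β ^ 2 - α ^ 2) * μ, (α ^ 2 + β ^ 2) ^ 2 * (1 / 2)]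
    (f := ![fun x => Sobolev.der w 2 x ^ 2, fun x => Sobolev.der w 0 x * Sobolev.der w 1 x ^ 2,
      fun x => Sobolev.der w 0 x ^ 4, fun x => Sobolev.der w 0 x ^ 2 * Sobolev.der w 1 x ^ 2,
      fun x => Sobolev.der w 0 x ^ 5, fun x => Sobolev.der w 0 x ^ 6,
      fun x => Sobolev.der w 1 x ^ 2, fun x => Sobolev.der w 0 x ^ 3,
      fun x => Sobolev.der w 0 x ^ 2]) (by
      intro i
      fin_cases i
      exacts [m2.integrable_sq, by simpa using i1 1, i0 2, i1 2, i0 3, i0 4, m1.integrable_sq,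
        i0 1, m0.integrable_sq])
  refine ⟨h1.congr (ae_of_all _ fun x => ?_), ?_⟩
  · simp [Fin.sum_univ_succ, lyapunovDensity]
    ring
  · calc lyapunov α β μ w = _ := ?_
      _ = _ := h2.symm
      _ = _ := integral_congr_ae (ae_of_all _ fun x => ?_)
    · simp [Fin.sum_univ_succ, lyapunov, thirdQuantity, energy, mass]
      ring
    · simp [Fin.sum_univ_succ, lyapunovDensity]
      ring

/-- The density of the quadratic form at a profile with values `b₀, b₁, b₂`. -/
def quadDensity (α β μ b₀ b₁ b₂ z₀ z₁ z₂ : ℝ) : ℝ :=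
  z₂ ^ 2 + (2 * (β ^ 2 - α ^ 2) - 5 * b₀ ^ 2 - 10 * μ * b₀) * z₁ ^ 2
    + ((α ^ 2 + β ^ 2) ^ 2
      + (5 * b₁ ^ 2 + 10 * b₀ * b₂ + 15 / 2 * b₀ ^ 4 - 6 * (β ^ 2 - α ^ 2) * b₀ ^ 2)
      + 3 * μ * (10 * b₀ ^ 3 - 4 * (β ^ 2 - α ^ 2) * b₀ + 10 / 3 * b₂ + 10 * μ * b₀ ^ 2)) * z₀ ^ 2

theorem exists_bound_on_box {c : ℝ × ℝ × ℝ → ℝ} (hc : Continuous c) (M : ℝ) :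
    ∃ K, 0 ≤ K ∧ ∀ x y z : ℝ, |x| ≤ M → |y| ≤ M → |z| ≤ M → |c (x, y, z)| ≤ K := by
  obtain ⟨K, hK⟩ := ((isCompact_Icc (a := -M) (b := M)).prod
    ((isCompact_Icc (a := -M) (b := M)).prod
      (isCompact_Icc (a := -M) (b := M)))).exists_bound_of_continuousOn hc.continuousOn
  refine ⟨max K 0, le_max_right _ _, fun x y z hx hy hz => le_max_of_le_left ?_⟩
  exact hK (x, y, z) ⟨abs_le.1 hx, abs_le.1 hy, abs_le.1 hz⟩

/-- A function with four bounded, continuous and square-integrable derivatives. -/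
structure IsProfile (C : ℝ) (D : Fin 5 → ℝ → ℝ) : Prop where
  hasDerivAt : ∀ (i : Fin 4) x, HasDerivAt (D i.castSucc) (D i.succ x) x
  abs_le : ∀ i x, |D i x| ≤ C
  memLp : ∀ i, MemLp (D i) 2 (volume : Measure ℝ)
  continuous : ∀ i, Continuous (D i)

namespace IsProfile

variable {C : ℝ} {D : Fin 5 → ℝ → ℝ}

theorem isWeakDeriv (h : IsProfile C D) (i : Fin 4) : IsWeakDeriv (D i.castSucc) (D i.succ) :=
  (IsPrimitive.of_hasDerivAt (h.hasDerivAt i) (h.continuous _)).isWeakDeriv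

theorem deriv_zero (h : IsProfile C D) : deriv (D 0) = D 1 :=
  funext fun x => (h.hasDerivAt 0 x).deriv

theorem deriv_one (h : IsProfile C D) : deriv (D 1) = D 2 :=
  funext fun x => (h.hasDerivAt 1 x).deriv

theorem exists_bound (h : IsProfile C D) {c : ℝ × ℝ × ℝ → ℝ} (hc : Continuous c) :
    ∃ K, ∀ x, |c (D 0 x, D 1 x, D 2 x)| ≤ K := by
  obtain ⟨K, -, hK⟩ := exists_bound_on_box hc C
  exact ⟨K, fun x => hK _ _ _ (h.abs_le _ _) (h.abs_le _ _) (h.abs_le _ _)⟩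

theorem integrable_coeff (h : IsProfile C D) {c : ℝ × ℝ × ℝ → ℝ} (hc : Continuous c)
    {f g : ℝ → ℝ} (hf : MemLp f 2 volume) (hg : MemLp g 2 volume) :
    Integrable (fun x => c (D 0 x, D 1 x, D 2 x) * (f x * g x)) := by
  obtain ⟨K, hK⟩ := h.exists_bound hc
  have hm : Continuous fun x => c (D 0 x, D 1 x, D 2 x) :=
    hc.comp ((h.continuous 0).prodMk ((h.continuous 1).prodMk (h.continuous 2)))
  exact integrable_weight hm.aestronglyMeasurable (ae_of_all _ hK) hf hg

/-- The Leibniz rule with a weight depending on the profile. -/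
theorem leibniz (h : IsProfile C D) {v v' : ℝ × ℝ × ℝ → ℝ} (hv : Continuous v)
    (hv' : Continuous v') (hd : ∀ x, HasDerivAt (fun x => v (D 0 x, D 1 x, D 2 x))
      (v' (D 0 x, D 1 x, D 2 x)) x) {f f' g g' : ℝ → ℝ} (hf : MemLp f 2 volume)
    (hf' : MemLp f' 2 volume) (hg : MemLp g 2 volume) (hg' : MemLp g' 2 volume)
    (hff : IsWeakDeriv f f') (hgg : IsWeakDeriv g g') :
    Integrable (fun x => v' (D 0 x, D 1 x, D 2 x) * (f x * g x)
        + v (D 0 x, D 1 x, D 2 x) * (f' x * g x) + v (D 0 x, D 1 x, D 2 x) * (f x * g' x)) ∧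
      ∫ x, (v' (D 0 x, D 1 x, D 2 x) * (f x * g x)
        + v (D 0 x, D 1 x, D 2 x) * (f' x * g x) + v (D 0 x, D 1 x, D 2 x) * (f x * g' x)) = 0 := by
  obtain ⟨K, hK⟩ := h.exists_bound hv
  obtain ⟨K', hK'⟩ := h.exists_bound hv'
  have hm : Continuous fun x => v' (D 0 x, D 1 x, D 2 x) :=
    hv'.comp ((h.continuous 0).prodMk ((h.continuous 1).prodMk (h.continuous 2)))
  exact integral_leibniz hf hf' hg hg' hff hgg hd hm
    (fun x => (hK x).trans (le_max_left K K')) fun x => (hK' x).trans (le_max_right K K')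

theorem quadForm_eq_integral (h : IsProfile C D) (α β μ : ℝ) (z : Sobolev 2) :
    Integrable (fun x => quadDensity α β μ (D 0 x) (D 1 x) (D 2 x) (Sobolev.der z 0 x)
      (Sobolev.der z 1 x) (Sobolev.der z 2 x)) ∧
    quadForm α β μ (D 0) z = ∫ x, quadDensity α β μ (D 0 x) (D 1 x) (D 2 x)
      (Sobolev.der z 0 x) (Sobolev.der z 1 x) (Sobolev.der z 2 x) := by
  have m0 := Sobolev.memLp_der z 0
  have m1 := Sobolev.memLp_der z 1
  have m2 := Sobolev.memLp_der z 2
  have hI : ∀ {c : ℝ × ℝ × ℝ → ℝ}, Continuous c → ∀ {f : ℝ → ℝ}, MemLp f 2 volume →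
      Integrable (fun x => c (D 0 x, D 1 x, D 2 x) * f x ^ 2) := fun hc f hf => by
    simpa only [← pow_two] using h.integrable_coeff hc hf hf
  obtain ⟨h1, h2⟩ := integral_sum_const_mul
    ![1, 2 * (β ^ 2 - α ^ 2), (α ^ 2 + β ^ 2) ^ 2, -5, -10 * μ, 1, 3 * μ]
    (f := ![fun x => Sobolev.der z 2 x ^ 2, fun x => Sobolev.der z 1 x ^ 2,
      fun x => Sobolev.der z 0 x ^ 2, fun x => D 0 x ^ 2 * Sobolev.der z 1 x ^ 2,
      fun x => D 0 x * Sobolev.der z 1 x ^ 2,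
      fun x => (5 * D 1 x ^ 2 + 10 * D 0 x * D 2 x + 15 / 2 * D 0 x ^ 4
        - 6 * (β ^ 2 - α ^ 2) * D 0 x ^ 2) * Sobolev.der z 0 x ^ 2,
      fun x => (10 * D 0 x ^ 3 - 4 * (β ^ 2 - α ^ 2) * D 0 x + 10 / 3 * D 2 x
        + 10 * μ * D 0 x ^ 2) * Sobolev.der z 0 x ^ 2]) (by
      intro i
      fin_cases i
      exacts [m2.integrable_sq, m1.integrable_sq, m0.integrable_sq,
        hI (c := fun q => q.1 ^ 2) (by fun_prop) m1, hI (c := fun q => q.1) (by fun_prop) m1,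
        hI (c := fun q => 5 * q.2.1 ^ 2 + 10 * q.1 * q.2.2 + 15 / 2 * q.1 ^ 4
          - 6 * (β ^ 2 - α ^ 2) * q.1 ^ 2) (by fun_prop) m0,
        hI (c := fun q => 10 * q.1 ^ 3 - 4 * (β ^ 2 - α ^ 2) * q.1 + 10 / 3 * q.2.2
          + 10 * μ * q.1 ^ 2) (by fun_prop) m0])
  refine ⟨h1.congr (ae_of_all _ fun x => ?_), ?_⟩
  · simp [Fin.sum_univ_succ, quadDensity]
    ring
  · calc quadForm α β μ (D 0) z = _ := ?_
      _ = _ := h2.symm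
      _ = _ := integral_congr_ae (ae_of_all _ fun x => ?_)
    · simp [Fin.sum_univ_succ, quadForm, h.deriv_zero, h.deriv_one]
      ring
    · simp [Fin.sum_univ_succ, quadDensity]
      ring

/-- The quadratic form is bounded on `H²`. -/
theorem exists_abs_quadForm_le (h : IsProfile C D) (α β μ : ℝ) :
    ∃ K, ∀ z : Sobolev 2, |quadForm α β μ (D 0) z| ≤ K * ‖z‖ ^ 2 := by
  obtain ⟨K₁, h₁⟩ := h.exists_bound
    (c := fun q => 2 * (β ^ 2 - α ^ 2) - 5 * q.1 ^ 2 - 10 * μ * q.1) (by fun_prop)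
  obtain ⟨K₀, h₀⟩ := h.exists_bound (c := fun q => (α ^ 2 + β ^ 2) ^ 2
      + (5 * q.2.1 ^ 2 + 10 * q.1 * q.2.2 + 15 / 2 * q.1 ^ 4 - 6 * (β ^ 2 - α ^ 2) * q.1 ^ 2)
      + 3 * μ * (10 * q.1 ^ 3 - 4 * (β ^ 2 - α ^ 2) * q.1 + 10 / 3 * q.2.2 + 10 * μ * q.1 ^ 2))
      (by fun_prop)
  have hK₁ : 0 ≤ K₁ := (abs_nonneg _).trans (h₁ 0)
  have hK₀ : 0 ≤ K₀ := (abs_nonneg _).trans (h₀ 0)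
  refine ⟨1 + K₁ + K₀, fun z => ?_⟩
  rw [(h.quadForm_eq_integral α β μ z).2]
  have s0 := (Sobolev.memLp_der z 0).integrable_sq
  have s1 := (Sobolev.memLp_der z 1).integrable_sq
  have s2 := (Sobolev.memLp_der z 2).integrable_sq
  have hint := (s2.add (s1.const_mul K₁)).add (s0.const_mul K₀)
  refine (norm_integral_le_of_norm_le (G := ℝ) hint (ae_of_all _ fun x => ?_)).trans ?_
  · unfold quadDensity
    refine (norm_add_le _ _).trans (add_le_add ((norm_add_le _ _).trans (add_le_add ?_ ?_)) ?_)
    · simp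
    · rw [norm_mul, Real.norm_of_nonneg (sq_nonneg (Sobolev.der z 1 x))]
      exact mul_le_mul_of_nonneg_right (h₁ x) (sq_nonneg _)
    · rw [norm_mul, Real.norm_of_nonneg (sq_nonneg (Sobolev.der z 0 x))]
      exact mul_le_mul_of_nonneg_right (h₀ x) (sq_nonneg _)
  · have e : ∫ x, (((fun x => Sobolev.der z 2 x ^ 2) + fun x => K₁ * Sobolev.der z 1 x ^ 2)
        + fun x => K₀ * Sobolev.der z 0 x ^ 2) x = (∫ x, Sobolev.der z 2 x ^ 2)
        + K₁ * (∫ x, Sobolev.der z 1 x ^ 2) + K₀ * ∫ x, Sobolev.der z 0 x ^ 2 := by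
      rw [integral_add' (s2.add (s1.const_mul K₁)) (s0.const_mul K₀),
        integral_add' s2 (s1.const_mul K₁), integral_const_mul, integral_const_mul]
    refine e.trans_le ?_
    have b0 := mul_le_mul_of_nonneg_left (Sobolev.integral_der_sq_le z 0) hK₀
    have b1 := mul_le_mul_of_nonneg_left (Sobolev.integral_der_sq_le z 1) hK₁
    have b2 := Sobolev.integral_der_sq_le z 2
    linarith

/-- On `H⁴` the quadratic form is given by the linearized operator. -/
theorem quadForm_eq_linearizedOp (h : IsProfile C D) (α β μ : ℝ) (u : Sobolev 4) (z : Sobolev 2)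
    (hz : Sobolev.der z 0 =ᵐ[volume] Sobolev.der u 0) :
    quadForm α β μ (D 0) z = ∫ x, Sobolev.der u 0 x * linearizedOp α β μ (D 0) u x := by
  have m := Sobolev.memLp_der u
  have hloc : ∀ {u : ℝ → ℝ}, MemLp u 2 volume → LocallyIntegrable u volume := fun hu =>
    hu.locallyIntegrable (by norm_num)
  -- `z` and `u` are assumed equal only at order zero; uniqueness of weak derivatives carries the
  -- equality to orders one and two.
  have hz1 : Sobolev.der z 1 =ᵐ[volume] Sobolev.der u 1 :=
    ((show IsWeakDeriv (Sobolev.der z 0) (Sobolev.der z 1) from z.2 0).congr hz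
      (Filter.EventuallyEq.refl _ _)).ae_unique (u.2 0) (hloc (Sobolev.memLp_der z 1)) (hloc (m 1))
  have hz2 : Sobolev.der z 2 =ᵐ[volume] Sobolev.der u 2 :=
    ((show IsWeakDeriv (Sobolev.der z 1) (Sobolev.der z 2) from z.2 1).congr hz1
      (Filter.EventuallyEq.refl _ _)).ae_unique (u.2 1) (hloc (Sobolev.memLp_der z 2)) (hloc (m 2))
  obtain ⟨i1, e1⟩ := h.quadForm_eq_integral α β μ z
  -- The exact derivatives `(u₁u₂)'` and `(u₀u₃)'` turn `u₂²` into `u₀u₄`; the weighted one below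
  -- turns the `u₁²` terms into terms in `u₀u₂` and `u₀u₁`.
  obtain ⟨i2, e2⟩ := h.leibniz (v := fun _ => 1) (v' := fun _ => 0) (by fun_prop) (by fun_prop)
    (fun x => hasDerivAt_const x _) (m 1) (m 2) (m 2) (m 3) (u.2 1) (u.2 2)
  obtain ⟨i3, e3⟩ := h.leibniz (v := fun _ => 1) (v' := fun _ => 0) (by fun_prop) (by fun_prop)
    (fun x => hasDerivAt_const x _) (m 0) (m 1) (m 3) (m 4) (u.2 0) (u.2 3)
  obtain ⟨i4, e4⟩ := h.leibniz
    (v := fun q => 2 * (β ^ 2 - α ^ 2) - 5 * q.1 ^ 2 - 10 * μ * q.1)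
    (v' := fun q => -10 * q.1 * q.2.1 - 10 * μ * q.2.1) (by fun_prop) (by fun_prop)
    (fun x => by
      have hd : HasDerivAt (D 0) (D 1 x) x := h.hasDerivAt 0 x
      refine HasDerivAt.congr_deriv (((hd.pow 2).const_mul 5).const_sub _ |>.sub
        (hd.const_mul (10 * μ))) ?_
      push_cast
      ring) (m 0) (m 1) (m 1) (m 2) (u.2 0) (u.2 1)
  obtain ⟨-, e5⟩ := integral_sum_const_mul ![1, -1, 1, -1] (f := ![_, _, _, _]) (by
      intro i
      fin_cases i
      exacts [i1, i2, i3, i4])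
  have e6 : ∀ a b c d : ℝ, b = 0 → c = 0 → d = 0 → a = 1 * a + -1 * b + 1 * c + -1 * d := by
    intros; simp [*]
  rw [e1]
  refine (e6 _ _ _ _ e2 e3 e4).trans ?_
  simp only [Fin.sum_univ_four] at e5
  refine e5.symm.trans (integral_congr_ae ?_)
  filter_upwards [hz, hz1, hz2] with x h0 h1 h2
  simp [linearizedOp, h.deriv_zero, h.deriv_one, h0, h1, h2]
  ring

end IsProfile

/-! ### Expansion of the Lyapunov functional around the breather -/

/-- The stationary equation at a profile with the values `b₀, b₁, b₂, b₄` of its derivatives. -/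
def stationary (α β μ b₀ b₁ b₂ b₄ : ℝ) : ℝ :=
  b₄ - 2 * (β ^ 2 - α ^ 2) * (b₂ + 3 * μ * b₀ ^ 2 + b₀ ^ 3)
    + (α ^ 2 + β ^ 2) ^ 2 * b₀ + 5 * b₀ * b₁ ^ 2 + 5 * b₀ ^ 2 * b₂
    + 3 / 2 * b₀ ^ 5 + 5 * μ * b₁ ^ 2 + 10 * μ * b₀ * b₂
    + 10 * μ ^ 2 * b₀ ^ 3 + 15 / 2 * μ * b₀ ^ 4

/-- The coefficients of the cubic remainder
`z₀ (remOne * z₁² + remTwo * (z₀ z₁) + remThree * z₀²)`. -/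
def remOne (μ b₀ z₀ : ℝ) : ℝ := -5 * μ - 5 * b₀ - 5 / 2 * z₀

def remTwo (b₁ : ℝ) : ℝ := -5 * b₁

def remThree (α β μ b₀ z₀ : ℝ) : ℝ :=
  5 / 2 * μ ^ 2 * (4 * b₀ + z₀) + 3 / 2 * μ * (10 * b₀ ^ 2 + 5 * b₀ * z₀ + z₀ ^ 2)
    + 1 / 4 * (20 * b₀ ^ 3 + 15 * b₀ ^ 2 * z₀ + 6 * b₀ * z₀ ^ 2 + z₀ ^ 3)
    + 2 * (β ^ 2 - α ^ 2) * (-μ - b₀ - 1 / 4 * z₀)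

def remainderDensity (α β μ b₀ b₁ z₀ z₁ : ℝ) : ℝ :=
  z₀ * (remOne μ b₀ z₀ * z₁ ^ 2 + remTwo b₁ * (z₀ * z₁) + remThree α β μ b₀ z₀ * z₀ ^ 2)

/-- The coefficients are continuous, hence bounded on a box determined by `C` and the bound `2` on
`z₀`. So `K` depends on the profile only through `C`. -/
theorem exists_abs_remainderDensity_le (α β μ C : ℝ) :
    ∃ K, 0 ≤ K ∧ ∀ b₀ b₁ z₀ z₁ : ℝ, |b₀| ≤ C → |b₁| ≤ C → |z₀| ≤ 2 →
      |remainderDensity α β μ b₀ b₁ z₀ z₁| ≤ K * (|z₀| * (z₀ ^ 2 + z₁ ^ 2)) := by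
  obtain ⟨K₁, p₁, h₁⟩ := exists_bound_on_box (c := fun q => remOne μ q.1 q.2.2)
    (by unfold remOne; fun_prop) (max C 2)
  obtain ⟨K₂, p₂, h₂⟩ := exists_bound_on_box (c := fun q => remTwo q.2.1)
    (by unfold remTwo; fun_prop) (max C 2)
  obtain ⟨K₃, p₃, h₃⟩ := exists_bound_on_box (c := fun q => remThree α β μ q.1 q.2.2)
    (by unfold remThree; fun_prop) (max C 2)
  refine ⟨K₁ + K₂ + K₃, by positivity, fun b₀ b₁ z₀ z₁ hb₀ hb₁ hz₀ => ?_⟩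
  have q₀ := hb₀.trans (le_max_left C 2)
  have q₁ := hb₁.trans (le_max_left C 2)
  have q₂ := hz₀.trans (le_max_right C 2)
  have e₁ : |remOne μ b₀ z₀ * z₁ ^ 2| ≤ K₁ * (z₀ ^ 2 + z₁ ^ 2) := by
    rw [abs_mul, abs_of_nonneg (sq_nonneg z₁)]
    exact mul_le_mul (h₁ _ _ _ q₀ q₁ q₂) (by nlinarith [sq_nonneg z₀]) (sq_nonneg _) p₁
  have e₂ : |remTwo b₁ * (z₀ * z₁)| ≤ K₂ * (z₀ ^ 2 + z₁ ^ 2) := by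
    rw [abs_mul]
    refine mul_le_mul (h₂ _ _ _ q₀ q₁ q₂) ?_ (abs_nonneg _) p₂
    exact abs_le.2 ⟨by nlinarith [sq_nonneg (z₀ + z₁)], by nlinarith [sq_nonneg (z₀ - z₁)]⟩
  have e₃ : |remThree α β μ b₀ z₀ * z₀ ^ 2| ≤ K₃ * (z₀ ^ 2 + z₁ ^ 2) := by
    rw [abs_mul, abs_of_nonneg (sq_nonneg z₀)]
    exact mul_le_mul (h₃ _ _ _ q₀ q₁ q₂) (by nlinarith [sq_nonneg z₁]) (sq_nonneg _) p₃
  unfold remainderDensity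
  rw [abs_mul]
  have := (abs_add_three (remOne μ b₀ z₀ * z₁ ^ 2) (remTwo b₁ * (z₀ * z₁))
    (remThree α β μ b₀ z₀ * z₀ ^ 2)).trans (add_le_add (add_le_add e₁ e₂) e₃)
  calc _ ≤ |z₀| * _ := mul_le_mul_of_nonneg_left this (abs_nonneg _)
    _ = _ := by ring

section Expansion

variable {α β μ C : ℝ} {D : Fin 5 → ℝ → ℝ} (h : IsProfile C D)
  (hstat : ∀ x, stationary α β μ (D 0 x) (D 1 x) (D 2 x) (D 4 x) = 0) {b : Sobolev 2}
  (hb0 : Sobolev.der b 0 =ᵐ[volume] D 0) (hb1 : Sobolev.der b 1 =ᵐ[volume] D 1)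
  (hb2 : Sobolev.der b 2 =ᵐ[volume] D 2)
include h hstat hb0 hb1 hb2

/-- The two sides differ pointwise by `z` times the stationary expression, which is zero, and by
exact derivatives of products of `H¹` functions with bounded weights, which integrate to zero. -/
theorem lyapunov_expansion (z : Sobolev 2) :
    lyapunov α β μ (b + z) - lyapunov α β μ b - 1 / 2 * quadForm α β μ (D 0) z
      = ∫ x, remainderDensity α β μ (D 0 x) (D 1 x) (Sobolev.der z 0 x) (Sobolev.der z 1 x) := by
  have m := Sobolev.memLp_der z
  obtain ⟨i1, e1⟩ := lyapunov_eq_integral α β μ (b + z)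
  obtain ⟨i2, e2⟩ := lyapunov_eq_integral α β μ b
  obtain ⟨i3, e3⟩ := h.quadForm_eq_integral α β μ z
  -- The first three exact derivatives move all derivatives off `z` in the linear terms. The fourth,
  -- of a weight times `z₀²`, turns the mixed quadratic terms `z₀z₁` into `z₀²` terms, as in the
  -- quadratic density.
  obtain ⟨i4, e4⟩ := h.leibniz (v := fun _ => 1) (v' := fun _ => 0) (by fun_prop) (by fun_prop)
    (fun x => hasDerivAt_const x _) (m 1) (m 2) (h.memLp 2) (h.memLp 3) (z.2 1) (h.isWeakDeriv 2)
  obtain ⟨i5, e5⟩ := h.leibniz (v := fun _ => 1) (v' := fun _ => 0) (by fun_prop) (by fun_prop)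
    (fun x => hasDerivAt_const x _) (m 0) (m 1) (h.memLp 3) (h.memLp 4) (z.2 0) (h.isWeakDeriv 3)
  have hd0 : ∀ x, HasDerivAt (D 0) (D 1 x) x := h.hasDerivAt 0
  have hd1 : ∀ x, HasDerivAt (D 1) (D 2 x) x := h.hasDerivAt 1
  obtain ⟨i6, e6⟩ := h.leibniz
    (v := fun q => 2 * (β ^ 2 - α ^ 2) - 5 * q.1 ^ 2 - 10 * μ * q.1)
    (v' := fun q => -10 * q.1 * q.2.1 - 10 * μ * q.2.1) (by fun_prop) (by fun_prop)
    (fun x => by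
      refine HasDerivAt.congr_deriv ((((hd0 x).pow 2).const_mul 5).const_sub _ |>.sub
        ((hd0 x).const_mul (10 * μ))) ?_
      push_cast
      ring) (m 0) (m 1) (h.memLp 1) (h.memLp 2) (z.2 0) (h.isWeakDeriv 1)
  obtain ⟨i7, e7⟩ := h.leibniz
    (v := fun q => 10 * μ * q.2.1 + 10 * (q.1 * q.2.1))
    (v' := fun q => 10 * μ * q.2.2 + 10 * (q.2.1 * q.2.1 + q.1 * q.2.2)) (by fun_prop)
    (by fun_prop)
    (fun x => ((hd1 x).const_mul (10 * μ)).add (((hd0 x).mul (hd1 x)).const_mul 10))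
    (m 0) (m 1) (m 0) (m 1) (z.2 0) (z.2 0)
  obtain ⟨-, e8⟩ := integral_sum_const_mul ![1, -1, -1 / 2, -1, 1, -1, 1 / 2]
    (f := ![_, _, _, _, _, _, _]) (by
      intro i
      fin_cases i
      exacts [i1, i2, i3, i4, i5, i6, i7])
  have e9 : ∀ a b c d e f g : ℝ, d = 0 → e = 0 → f = 0 → g = 0 → a - b - 1 / 2 * c
      = 1 * a + (-1 * b + (-1 / 2 * c + (-1 * d + (1 * e + (-1 * f + 1 / 2 * g))))) := by
    intro a b c d e f g h1 h2 h3 h4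
    rw [h1, h2, h3, h4]
    ring
  rw [e1, e2, e3]
  refine (e9 _ _ _ _ _ _ _ e4 e5 e6 e7).trans ?_
  simp only [Fin.sum_univ_succ, Fin.sum_univ_zero, add_zero] at e8
  refine e8.symm.trans (integral_congr_ae ?_)
  filter_upwards [hb0, hb1, hb2, Sobolev.der_add b z 0, Sobolev.der_add b z 1,
    Sobolev.der_add b z 2] with x h0 h1 h2 a0 a1 a2
  have hs := hstat x
  simp [a0, a1, a2, h0, h1, h2]
  unfold stationary at hs
  unfold remainderDensity remOne remTwo remThree
  linear_combination Sobolev.der z 0 x * hs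

end Expansion

/-- `K` is chosen before `D` and `b`, which makes the final constant uniform in `x₁, x₂, t`. The sup
norm of `z` supplies one power of `‖z‖`, the integrals of `z₀²` and `z₁²` the other two. -/
theorem exists_remainder_bound (α β μ C : ℝ) : ∃ K, ∀ (D : Fin 5 → ℝ → ℝ) (b : Sobolev 2),
    IsProfile C D → (∀ x, stationary α β μ (D 0 x) (D 1 x) (D 2 x) (D 4 x) = 0) →
    Sobolev.der b 0 =ᵐ[volume] D 0 → Sobolev.der b 1 =ᵐ[volume] D 1 →
    Sobolev.der b 2 =ᵐ[volume] D 2 → ∀ z : Sobolev 2, ‖z‖ ≤ 1 →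
      |lyapunov α β μ (b + z) - lyapunov α β μ b - 1 / 2 * quadForm α β μ (D 0) z|
        ≤ K * ‖z‖ ^ 3 := by
  obtain ⟨K, hK0, hK⟩ := exists_abs_remainderDensity_le α β μ C
  refine ⟨4 * K, fun D b h hstat hb0 hb1 hb2 z hz => ?_⟩
  rw [lyapunov_expansion h hstat hb0 hb1 hb2 z]
  have s0 := (Sobolev.memLp_der z 0).integrable_sq
  have s1 := (Sobolev.memLp_der z 1).integrable_sq
  have hint := (s0.add s1).const_mul (K * (2 * ‖z‖))
  refine (norm_integral_le_of_norm_le (G := ℝ) hint ?_).trans ?_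
  · filter_upwards [Sobolev.ae_abs_der_zero_le z] with x hx
    refine (hK _ _ _ _ (h.abs_le 0 x) (h.abs_le 1 x) (by linarith)).trans ?_
    rw [mul_assoc]
    have : 0 ≤ Sobolev.der z 0 x ^ 2 + Sobolev.der z 1 x ^ 2 := by positivity
    exact mul_le_mul_of_nonneg_left (mul_le_mul_of_nonneg_right hx this) hK0
  · rw [integral_const_mul, integral_add' s0 s1]
    have b0 := Sobolev.integral_der_sq_le z 0
    have b1 := Sobolev.integral_der_sq_le z 1
    have hn : 0 ≤ K * (2 * ‖z‖) := by positivity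
    calc _ ≤ K * (2 * ‖z‖) * (‖z‖ ^ 2 + ‖z‖ ^ 2) :=
          mul_le_mul_of_nonneg_left (add_le_add b0 b1) hn
      _ = _ := by ring

/-- A square-integrable profile as an element of `H²`. -/
theorem IsProfile.exists_sobolev {C : ℝ} {D : Fin 5 → ℝ → ℝ} (h : IsProfile C D) :
    ∃ b : Sobolev 2, Sobolev.der b 0 =ᵐ[volume] D 0 ∧ Sobolev.der b 1 =ᵐ[volume] D 1 ∧
      Sobolev.der b 2 =ᵐ[volume] D 2 := by
  refine ⟨⟨WithLp.toLp 2 ![(h.memLp 0).toLp, (h.memLp 1).toLp, (h.memLp 2).toLp], ?_⟩,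
    MemLp.coeFn_toLp (h.memLp 0), MemLp.coeFn_toLp (h.memLp 1), MemLp.coeFn_toLp (h.memLp 2)⟩
  intro i
  fin_cases i
  · exact (h.isWeakDeriv 0).congr (h.memLp 0).coeFn_toLp.symm (h.memLp 1).coeFn_toLp.symm
  · exact (h.isWeakDeriv 1).congr (h.memLp 1).coeFn_toLp.symm (h.memLp 2).coeFn_toLp.symm

/-- A functional that is quadratically close to its value at a point is critical there. -/
theorem hasFDerivAt_zero_of_quadratic {E : Type*} [NormedAddCommGroup E] [NormedSpace ℝ E]
    {f : E → ℝ} {b : E} {K : ℝ} (h : ∀ z, ‖z‖ ≤ 1 → |f (b + z) - f b| ≤ K * ‖z‖ ^ 2) :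
    HasFDerivAt f (0 : E →L[ℝ] ℝ) b := by
  have hO : (fun y => f y - f b) =O[nhds b] fun y => ‖y - b‖ ^ 2 := by
    refine Asymptotics.IsBigO.of_bound K ?_
    filter_upwards [Metric.closedBall_mem_nhds b one_pos] with y hy
    have := h (y - b) (by rwa [mem_closedBall_iff_norm] at hy)
    rwa [add_sub_cancel, ← Real.norm_eq_abs, ← norm_norm (y - b), ← norm_pow] at this
  simpa using (hO.hasFDerivAt one_lt_two).add_const (f b)

end Gardner

end

/-! ### The main theorem -/

theorem lemma4p3 (α β μ : ℝ) (hα : α ≠ 0) (hβ : β ≠ 0) (hμ : μ ≠ 0)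
    (hΔ : 0 < Gardner.Del α β μ) :
    ∃ η > (0 : ℝ), ∃ K : ℝ, ∀ x₁ x₂ t : ℝ,
      ∃ b : Gardner.Sobolev 2,
        -- `b` is the breather at time `t`, as an element of `H²(ℝ)`
        Gardner.Sobolev.der b 0 =ᵐ[MeasureTheory.volume] Gardner.breather α β μ x₁ x₂ t ∧
        -- it is a critical point of the Lyapunov functional
        HasFDerivAt (Gardner.lyapunov α β μ) (0 : Gardner.Sobolev 2 →L[ℝ] ℝ) b ∧
        -- on `H⁴(ℝ)` the quadratic form is the one of the linearized operator
        (∀ (u : Gardner.Sobolev 4) (z : Gardner.Sobolev 2),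
          Gardner.Sobolev.der z 0 =ᵐ[MeasureTheory.volume] Gardner.Sobolev.der u 0 →
          Gardner.quadForm α β μ (Gardner.breather α β μ x₁ x₂ t) z =
            ∫ x, Gardner.Sobolev.der u 0 x *
              Gardner.linearizedOp α β μ (Gardner.breather α β μ x₁ x₂ t) u x) ∧
        -- the expansion, with a remainder that is cubic, uniformly in `x₁, x₂, t`
        ∃ N : Gardner.Sobolev 2 → ℝ, ∀ z : Gardner.Sobolev 2, ‖z‖ ≤ η →
          Gardner.lyapunov α β μ (b + z) - Gardner.lyapunov α β μ b =
              1 / 2 * Gardner.quadForm α β μ (Gardner.breather α β μ x₁ x₂ t) z + N z ∧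
            |N z| ≤ K * ‖z‖ ^ 3 := by
  obtain ⟨C, hC⟩ := Gardner.exists_breather_derivs hα hβ hΔ
  obtain ⟨K, hK⟩ := Gardner.exists_remainder_bound α β μ C
  -- Radius one suffices: the embedding then gives `|z| ≤ 2`, the box on which the remainder
  -- coefficients were bounded.
  refine ⟨1, one_pos, K, fun x₁ x₂ t => ?_⟩
  obtain ⟨D, hD0, hder, hbd, hLp, hcont, hstat⟩ := hC x₁ x₂ t
  have hP : Gardner.IsProfile C D := ⟨hder, hbd, hLp, hcont⟩
  obtain ⟨b, hb0, hb1, hb2⟩ := hP.exists_sobolev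
  have hrem := hK D b hP hstat hb0 hb1 hb2
  rw [← hD0]
  refine ⟨b, hb0, ?_, fun u z hz => hP.quadForm_eq_linearizedOp α β μ u z hz,
    fun z => Gardner.lyapunov α β μ (b + z) - Gardner.lyapunov α β μ b
      - 1 / 2 * Gardner.quadForm α β μ (D 0) z, fun z hz => ⟨by ring, hrem z hz⟩⟩
  obtain ⟨Q, hQ⟩ := hP.exists_abs_quadForm_le α β μ
  -- For `‖z‖ ≤ 1` the cubic remainder is also at most quadratic. The bound `Q` may depend on the
  -- phases, since criticality is a statement about a single breather.
  refine Gardner.hasFDerivAt_zero_of_quadratic (K := |K| + 1 / 2 * Q) fun z hz => ?_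
  have h1 := hrem z hz
  have h2 := hQ z
  have h3 : K * ‖z‖ ^ 3 ≤ |K| * ‖z‖ ^ 2 := by
    have h4 : ‖z‖ ^ 3 ≤ ‖z‖ ^ 2 := pow_le_pow_of_le_one (norm_nonneg _) hz (by norm_num)
    exact (mul_le_mul_of_nonneg_right (le_abs_self K) (by positivity)).trans
      (mul_le_mul_of_nonneg_left h4 (abs_nonneg _))
  rw [abs_le] at h1 h2 ⊢
  constructor <;> linarith [h1.1, h1.2, h2.1, h2.2]
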